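/- Consider the real RAM with unit-cost operations: its memory consists of real cells and integer cells with indirect addressing, its operations on reals are $+,-,\times,/,\sqrt{\ }$ and comparison (with rational constants), and its operations on integer indices are addition, subtraction, halving and comparison. There are a single deterministic program for this machine and an absolute constant $K$ with the following property. For every real $\epsilon$ with $0<\epsilon\le 1$, every $n\ge 1$ and every family $\mathcal{D}=(D_1,\dots,D_n)$ of $n$ closed disks in the Euclidean plane (radius $0$ is permitted), the program, given $n$, $\epsilon$ and the coordinates of the centers and the radii of the disks in $\mathcal D$ as input, halts after at most $K\,\frac{n}{\epsilon}\log(n+1)$ steps, and outputs two closed disks $C_1,C_2$ of equal radius $r$ such that 1. every $D_i$ is contained in $C_1$ or contained in $C_2$ (that is, $(C_1,C_2)$ is a solution of the restricted covering problem for $\mathcal{D}$), and 2. $r\le(1+\epsilon)\,r'$ whenever $C_1',C_2'$ are two closed disks of equal radius $r'$ such that every $D_i$ is contained in $C_1'$ or contained in $C_2'$. In other words, a $(1+\epsilon)$-approximation for the restricted covering problem can be computed in $O((n/\epsilon)\log n)$ time. -/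

import Mathlib

/-! ### A real random access machine

A state consists of zero-initialised arrays of natural numbers (indices, counters) and of real
numbers. A program is a fixed structured program, so it refers to finitely many arrays only; the
cells of each array are addressed indirectly, by computed indices. The operations on reals are
`+`, `-`, `*`, `/`, square root and comparison (no floor, no trigonometric functions, and only
rational literals); the operations on indices are `+`, truncated `-`, halving and comparison.
Every operation, memory access, literal, comparison, assignment and branching costs one step. -/

namespace RealRAM

structure State where
  nat : ℕ → ℕ → ℕ
  real : ℕ → ℕ → ℝ

/-- Write `v` to cell `i` of the natural number array `a`. -/
def State.setNat (s : State) (a i v : ℕ) : State :=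
  { s with nat := fun a' i' => if a' = a ∧ i' = i then v else s.nat a' i' }

/-- Write `v` to cell `i` of the real array `a`. -/
def State.setReal (s : State) (a i : ℕ) (v : ℝ) : State :=
  { s with real := fun a' i' => if a' = a ∧ i' = i then v else s.real a' i' }

/-- Index expressions; `cell a e` reads cell `e` of the natural number array `a`. -/
inductive NExp where
  | lit (k : ℕ)
  | cell (a : ℕ) (e : NExp)
  | add (e f : NExp)
  | sub (e f : NExp)
  | half (e : NExp)

def NExp.eval (s : State) : NExp → ℕ
  | .lit k => k
  | .cell a e => s.nat a (e.eval s)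
  | .add e f => e.eval s + f.eval s
  | .sub e f => e.eval s - f.eval s
  | .half e => e.eval s / 2

def NExp.cost : NExp → ℕ
  | .lit _ => 1
  | .cell _ e => e.cost + 1
  | .add e f => e.cost + f.cost + 1
  | .sub e f => e.cost + f.cost + 1
  | .half e => e.cost + 1

/-- Real expressions; `cell a e` reads cell `e` of the real array `a`. -/
inductive RExp where
  | lit (q : ℚ)
  | cell (a : ℕ) (e : NExp)
  | add (e f : RExp)
  | sub (e f : RExp)
  | mul (e f : RExp)
  | div (e f : RExp)
  | sqrt (e : RExp)

/-- Division by zero and the square root of a negative number return `0`. -/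
noncomputable def RExp.eval (s : State) : RExp → ℝ
  | .lit q => (q : ℝ)
  | .cell a e => s.real a (e.eval s)
  | .add e f => e.eval s + f.eval s
  | .sub e f => e.eval s - f.eval s
  | .mul e f => e.eval s * f.eval s
  | .div e f => e.eval s / f.eval s
  | .sqrt e => Real.sqrt (e.eval s)

def RExp.cost : RExp → ℕ
  | .lit _ => 1
  | .cell _ e => e.cost + 1
  | .add e f => e.cost + f.cost + 1
  | .sub e f => e.cost + f.cost + 1
  | .mul e f => e.cost + f.cost + 1
  | .div e f => e.cost + f.cost + 1
  | .sqrt e => e.cost + 1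

/-- Tests. -/
inductive BExp where
  | natLt (e f : NExp)
  | realLt (e f : RExp)
  | not (b : BExp)
  | and (b c : BExp)

def BExp.eval (s : State) : BExp → Prop
  | .natLt e f => e.eval s < f.eval s
  | .realLt e f => e.eval s < f.eval s
  | .not b => ¬ b.eval s
  | .and b c => b.eval s ∧ c.eval s

def BExp.cost : BExp → ℕ
  | .natLt e f => e.cost + f.cost + 1
  | .realLt e f => e.cost + f.cost + 1
  | .not b => b.cost + 1
  | .and b c => b.cost + c.cost + 1

/-- Programs; `setNat a i e` and `setReal a i e` assign the value of `e` to cell `i` of array `a`. -/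
inductive Prog where
  | skip
  | setNat (a : ℕ) (i e : NExp)
  | setReal (a : ℕ) (i : NExp) (e : RExp)
  | seq (p q : Prog)
  | cond (b : BExp) (p q : Prog)
  | loop (b : BExp) (p : Prog)

/-- `Exec p s t s'`: started in state `s`, the program `p` halts after exactly `t` steps in
state `s'`. -/
inductive Exec : Prog → State → ℕ → State → Prop
  | skip (s : State) : Exec .skip s 1 s
  | setNat (a : ℕ) (i e : NExp) (s : State) :
      Exec (.setNat a i e) s (i.cost + e.cost + 1) (s.setNat a (i.eval s) (e.eval s))
  | setReal (a : ℕ) (i : NExp) (e : RExp) (s : State) :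
      Exec (.setReal a i e) s (i.cost + e.cost + 1) (s.setReal a (i.eval s) (e.eval s))
  | seq {p q : Prog} {s s' s'' : State} {t u : ℕ} :
      Exec p s t s' → Exec q s' u s'' → Exec (.seq p q) s (t + u) s''
  | condTrue {b : BExp} {p q : Prog} {s s' : State} {t : ℕ} :
      b.eval s → Exec p s t s' → Exec (.cond b p q) s (b.cost + t + 1) s'
  | condFalse {b : BExp} {p q : Prog} {s s' : State} {t : ℕ} :
      ¬ b.eval s → Exec q s t s' → Exec (.cond b p q) s (b.cost + t + 1) s'
  | loopTrue {b : BExp} {p : Prog} {s s' s'' : State} {t u : ℕ} :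
      b.eval s → Exec p s t s' → Exec (.loop b p) s' u s'' →
      Exec (.loop b p) s (b.cost + t + u + 1) s''
  | loopFalse {b : BExp} {p : Prog} {s : State} :
      ¬ b.eval s → Exec (.loop b p) s (b.cost + 1) s

end RealRAM

/-! ### The restricted two-center covering problem for disks -/

namespace TwoCenter

abbrev Plane := EuclideanSpace ℝ (Fin 2)

/-- A closed disk in the plane, given by its center and its radius; radius `0` is permitted. -/
structure Disk where
  center : Plane
  radius : ℝ
  radius_nonneg : 0 ≤ radius

/-- The set of points of a disk. -/
def Disk.carrier (D : Disk) : Set Plane := Metric.closedBall D.center D.radius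

/-- `C₁` and `C₂` are congruent, and each input disk is contained in `C₁` or contained in `C₂`. -/
def IsRestrictedCover {n : ℕ} (D : Fin n → Disk) (C₁ C₂ : Disk) : Prop :=
  C₁.radius = C₂.radius ∧ ∀ i, (D i).carrier ⊆ C₁.carrier ∨ (D i).carrier ⊆ C₂.carrier

/-- A solution of the restricted covering problem whose radius is at most `ρ` times the radius of
any solution (hence at most `ρ` times the optimal radius). -/
def IsApproxRestrictedCover {n : ℕ} (ρ : ℝ) (D : Fin n → Disk) (C₁ C₂ : Disk) : Prop :=
  IsRestrictedCover D C₁ C₂ ∧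
    ∀ C₁' C₂' : Disk, IsRestrictedCover D C₁' C₂' → C₁.radius ≤ ρ * C₁'.radius

open RealRAM

/-- The initial state: `n` is in cell `0` of natural number array `0`, `ε` is in cell `0` of real
array `0`, the two coordinates of the centers and the radii are in the cells `0, …, n - 1` of the
real arrays `1`, `2` and `3`; everything else is `0`. -/
noncomputable def input {n : ℕ} (ε : ℝ) (D : Fin n → Disk) : State where
  nat a i := if a = 0 ∧ i = 0 then n else 0
  real a i :=
    if a = 0 ∧ i = 0 then ε
    else if h : i < n then
      if a = 1 then (D ⟨i, h⟩).center 0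
      else if a = 2 then (D ⟨i, h⟩).center 1
      else if a = 3 then (D ⟨i, h⟩).radius
      else 0
    else 0

/-- The final state `s` holds the answer `C₁`, `C₂` in the cells `0, …, 5` of real array `4`. -/
def IsOutput (s : State) (C₁ C₂ : Disk) : Prop :=
  C₁.center 0 = s.real 4 0 ∧ C₁.center 1 = s.real 4 1 ∧ C₁.radius = s.real 4 2 ∧
  C₂.center 0 = s.real 4 3 ∧ C₂.center 1 = s.real 4 4 ∧ C₂.radius = s.real 4 5

end TwoCenter

/-!
In a solution, assigning every disk to the closer of the two covering centers splits the family by a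
line orthogonal to the direction joining them. Conversely, for a given direction and a given radius,
the largest prefix of the disks that fits into a disk of this radius leaves the smallest suffix, and
both are found by the ellipsoid method: the center of the first disk in the given direction that the
current disk does not contain determines a cut, so `O(log (1/ε))` linear scans suffice, up to
a factor `1 + O(ε)` in the radius.

For the direction there are two kinds of candidates. A net of `O(1/ε)` directions contains one
that costs only a factor `1 + O(ε)`. On the other hand, the separable splits do not change as the
direction varies between two normals of difference vectors of centers, so one of the `O(n⁴)`
bisectors of such vectors is exact. Using the net if `n⁸ ε > 1` and the bisectors otherwise, the
`log (1/ε)` is `O(log n)`, respectively absorbed by `1/ε`.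

The disks around an arbitrary center and around the farthest one from it give a `2`-approximation.
Its radius is lowered by factors `1 + η`. A direction that fails for one radius fails for all
smaller ones, so the number of tests is the number of directions plus the number of improvements,
which is `O(1/η)` for the net, where `η` is the precision, and bounded for the bisectors, where
`η` is halved from `1` down to the precision.
-/

/-! ### Programs: running time and frame conditions -/

namespace RealRAM

infixr:60 ";;" => Prog.seq

/-- The syntactic size of a program, counted such that running the program once, each of its loops
being cut off after the first test, costs at most as many steps. It absorbs all constant factors
of the running times below. -/
def Prog.size : Prog → ℕ
  | .skip => 1
  | .setNat _ i e => i.cost + e.cost + 1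
  | .setReal _ i e => i.cost + e.cost + 1
  | .seq p q => p.size + q.size
  | .cond b p q => b.cost + p.size + q.size + 1
  | .loop b p => b.cost + p.size + 1

open Classical in
/-- The effect of a loop-free program on a state; loops are ignored. -/
noncomputable def Prog.eff : Prog → State → State
  | .skip, s => s
  | .setNat a i e, s => s.setNat a (i.eval s) (e.eval s)
  | .setReal a i e, s => s.setReal a (i.eval s) (e.eval s)
  | .seq p q, s => q.eff (p.eff s)
  | .cond b p q, s => if b.eval s then p.eff s else q.eff s
  | .loop _ _, s => s

/-- Whether a program has no loops. -/
def Prog.loopFree : Prog → Bool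
  | .seq p q => p.loopFree && q.loopFree
  | .cond _ p q => p.loopFree && q.loopFree
  | .loop _ _ => false
  | _ => true

/-- The natural number arrays a program may write to. -/
def Prog.natWrites : Prog → List ℕ
  | .setNat a _ _ => [a]
  | .seq p q => p.natWrites ++ q.natWrites
  | .cond _ p q => p.natWrites ++ q.natWrites
  | .loop _ p => p.natWrites
  | _ => []

/-- The real arrays a program may write to. -/
def Prog.realWrites : Prog → List ℕ
  | .setReal a _ _ => [a]
  | .seq p q => p.realWrites ++ q.realWrites
  | .cond _ p q => p.realWrites ++ q.realWrites
  | .loop _ p => p.realWrites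
  | _ => []

/-- The states `s` and `s'` agree on all arrays that `p` does not write to. -/
structure Frame (p : Prog) (s s' : State) : Prop where
  nat_eq : ∀ a ∉ p.natWrites, s'.nat a = s.nat a
  real_eq : ∀ a ∉ p.realWrites, s'.real a = s.real a

namespace Frame

variable {p q : Prog} {s s' s'' : State}

theorem refl (p : Prog) (s : State) : Frame p s s := ⟨fun _ _ => rfl, fun _ _ => rfl⟩

theorem trans (h : Frame p s s') (h' : Frame p s' s'') : Frame p s s'' :=
  ⟨fun a ha => (h'.nat_eq a ha).trans (h.nat_eq a ha),
    fun a ha => (h'.real_eq a ha).trans (h.real_eq a ha)⟩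

theorem mono (h : Frame p s s') (hn : p.natWrites ⊆ q.natWrites)
    (hr : p.realWrites ⊆ q.realWrites) : Frame q s s' :=
  ⟨fun a ha => h.nat_eq a fun h' => ha (hn h'), fun a ha => h.real_eq a fun h' => ha (hr h')⟩

theorem nat (h : Frame p s s') (a i : ℕ) (ha : a ∉ p.natWrites := by decide) :
    s'.nat a i = s.nat a i := by rw [h.nat_eq a ha]

theorem real (h : Frame p s s') (a i : ℕ) (ha : a ∉ p.realWrites := by decide) :
    s'.real a i = s.real a i := by rw [h.real_eq a ha]

end Frame

theorem Exec.frame {p : Prog} {s s' : State} {t : ℕ} (h : Exec p s t s') : Frame p s s' := by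
  induction h with
  | skip s => exact .refl _ s
  | setNat a i e s =>
    refine ⟨fun b hb => ?_, fun _ _ => rfl⟩
    funext j
    simp_all [State.setNat, Prog.natWrites]
  | setReal a i e s =>
    refine ⟨fun _ _ => rfl, fun b hb => ?_⟩
    funext j
    simp_all [State.setReal, Prog.realWrites]
  | seq _ _ ih₁ ih₂ =>
    exact (ih₁.mono (List.subset_append_left ..) (List.subset_append_left ..)).trans
      (ih₂.mono (List.subset_append_right ..) (List.subset_append_right ..))
  | condTrue _ _ ih => exact ih.mono (List.subset_append_left ..) (List.subset_append_left ..)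
  | condFalse _ _ ih => exact ih.mono (List.subset_append_right ..) (List.subset_append_right ..)
  | loopTrue _ _ _ ih₁ ih₂ =>
    exact (ih₁.mono (q := .loop _ _) (List.Subset.refl _) (List.Subset.refl _)).trans ih₂
  | loopFalse _ => exact .refl _ _

/-- Started in `s`, the program `p` halts in a state satisfying `Q`, and its running time is at
most `W`, up to the constant `p.size`. -/
def Runs (p : Prog) (s : State) (W : ℕ) (Q : State → Prop) : Prop :=
  ∃ t s', Exec p s t s' ∧ t ≤ p.size * W ∧ Q s'

theorem exec_eff {p : Prog} (hp : p.loopFree = true) (s : State) :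
    ∃ t ≤ p.size, Exec p s t (p.eff s) := by
  induction p generalizing s with
  | skip => exact ⟨1, le_rfl, .skip s⟩
  | setNat a i e => exact ⟨_, le_rfl, .setNat a i e s⟩
  | setReal a i e => exact ⟨_, le_rfl, .setReal a i e s⟩
  | seq p q ihp ihq =>
    obtain ⟨hp, hq⟩ := Bool.and_eq_true_iff.1 hp
    obtain ⟨t, ht, h⟩ := ihp hp s
    obtain ⟨u, hu, h'⟩ := ihq hq (p.eff s)
    exact ⟨t + u, Nat.add_le_add ht hu, .seq h h'⟩
  | cond b p q ihp ihq =>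
    obtain ⟨hp, hq⟩ := Bool.and_eq_true_iff.1 hp
    by_cases hb : b.eval s
    · obtain ⟨t, ht, h⟩ := ihp hp s
      refine ⟨b.cost + t + 1, by simp only [Prog.size]; omega, ?_⟩
      simpa only [Prog.eff, if_pos hb] using .condTrue hb h
    · obtain ⟨t, ht, h⟩ := ihq hq s
      refine ⟨b.cost + t + 1, by simp only [Prog.size]; omega, ?_⟩
      simpa only [Prog.eff, if_neg hb] using .condFalse hb h
  | loop b p => cases hp

theorem Frame.eff {p : Prog} (hp : p.loopFree = true) (s : State) : Frame p s (p.eff s) :=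
  let ⟨_, _, h⟩ := exec_eff hp s
  h.frame

namespace Runs

variable {p q : Prog} {s : State} {W W' : ℕ} {Q R : State → Prop}

theorem mono (h : Runs p s W Q) (hW : W ≤ W') (hQ : ∀ s', Frame p s s' → Q s' → R s') :
    Runs p s W' R := by
  obtain ⟨t, s', he, ht, hq⟩ := h
  exact ⟨t, s', he, ht.trans (Nat.mul_le_mul_left _ hW), hQ s' he.frame hq⟩

theorem imp (h : Runs p s W Q) (hQ : ∀ s', Frame p s s' → Q s' → R s') : Runs p s W R :=
  h.mono le_rfl hQ

theorem straight (hp : p.loopFree = true) (hQ : Q (p.eff s)) (hW : 0 < W := by positivity) :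
    Runs p s W Q := by
  obtain ⟨t, ht, h⟩ := exec_eff hp s
  exact ⟨t, _, h, ht.trans (Nat.le_mul_of_pos_right _ hW), hQ⟩

theorem seq (h : Runs p s W Q) (h' : ∀ s', Frame p s s' → Q s' → Runs q s' W R) :
    Runs (p ;; q) s W R := by
  obtain ⟨t, s', he, ht, hq⟩ := h
  obtain ⟨u, s'', he', hu, hr⟩ := h' s' he.frame hq
  exact ⟨t + u, s'', .seq he he', by rw [Prog.size, add_mul]; omega, hr⟩

theorem straight_seq (hp : p.loopFree = true)
    (h : Frame p s (p.eff s) → Runs q (p.eff s) W R) (hW : 0 < W := by positivity) :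
    Runs (p ;; q) s W R :=
  seq (straight (Q := (· = p.eff s)) hp rfl hW) fun _ _ hs' => hs' ▸ h (.eff hp s)

theorem cond {b : BExp} (hp : b.eval s → Runs p s W Q) (hq : ¬ b.eval s → Runs q s W Q)
    (hW : 0 < W := by positivity) : Runs (.cond b p q) s W Q := by
  have hb_cost : b.cost + 1 ≤ (b.cost + 1) * W := Nat.le_mul_of_pos_right _ hW
  have hsize : (Prog.cond b p q).size * W = (b.cost + 1) * W + p.size * W + q.size * W := by
    rw [Prog.size]; ring
  by_cases hb : b.eval s
  · obtain ⟨t, s', he, ht, h⟩ := hp hb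
    exact ⟨_, s', .condTrue hb he, by omega, h⟩
  · obtain ⟨t, s', he, ht, h⟩ := hq hb
    exact ⟨_, s', .condFalse hb he, by omega, h⟩

/-- `I m s` may hold only in states from which at most `m` iterations remain. -/
theorem loop {b : BExp} (I : ℕ → State → Prop) (m : ℕ) (h₀ : I m s)
    (hstep : ∀ m s', Frame p s s' → I m s' → b.eval s' → ∃ m', m = m' + 1 ∧ Runs p s' W (I m'))
    (hend : ∀ m s', Frame p s s' → I m s' → ¬ b.eval s' → Q s') (hW : 0 < W := by positivity) :
    Runs (.loop b p) s ((m + 1) * W) Q := by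
  have hb_cost : b.cost + 1 ≤ (b.cost + 1) * W := Nat.le_mul_of_pos_right _ hW
  have hsize : ∀ k, (Prog.loop b p).size * (k * W) = k * (p.size * W + (b.cost + 1) * W) :=
    fun k => by rw [Prog.size]; ring
  have halt : ∀ k s', Frame p s s' → I k s' → ¬ b.eval s' →
      Runs (.loop b p) s' ((k + 1) * W) Q := fun k s' hF h hb =>
    ⟨_, s', .loopFalse hb, by rw [hsize, add_one_mul k]; omega, hend k s' hF h hb⟩
  suffices H : ∀ m s', Frame p s s' → I m s' → Runs (.loop b p) s' ((m + 1) * W) Q from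
    H m s (.refl _ _) h₀
  intro m
  induction m with
  | zero =>
    intro s' hF h
    by_cases hb : b.eval s'
    · obtain ⟨m', hm, -⟩ := hstep 0 s' hF h hb
      omega
    · exact halt 0 s' hF h hb
  | succ m ih =>
    intro s' hF h
    by_cases hb : b.eval s'
    · obtain ⟨m', hm, t, s₁, he, ht, hI⟩ := hstep _ s' hF h hb
      obtain rfl : m = m' := by omega
      obtain ⟨u, s₂, he', hu, hq⟩ := ih s₁ (hF.trans he.frame) hI
      refine ⟨_, s₂, .loopTrue hb he he', ?_, hq⟩
      rw [hsize] at hu ⊢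
      rw [add_one_mul (m + 1)]
      omega
    · exact halt _ s' hF h hb

end Runs

/-! ### Variables, vectors and for-loops -/

section Accessors

variable (s : State) (a i : ℕ)

@[simp] theorem setNat_nat (v a' i' : ℕ) :
    (s.setNat a i v).nat a' i' = if a' = a ∧ i' = i then v else s.nat a' i' := rfl

@[simp] theorem setNat_real (v : ℕ) : (s.setNat a i v).real = s.real := rfl

@[simp] theorem setReal_real (v : ℝ) (a' i' : ℕ) :
    (s.setReal a i v).real a' i' = if a' = a ∧ i' = i then v else s.real a' i' := rfl

@[simp] theorem setReal_nat (v : ℝ) : (s.setReal a i v).nat = s.nat := rfl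

end Accessors

/-- Cell `0` of a natural number array, used as a variable. -/
abbrev nv (a : ℕ) : NExp := .cell a (.lit 0)

/-- Cell `0` of a real array, used as a variable. -/
abbrev rv (a : ℕ) : RExp := .cell a (.lit 0)

/-- Assignment to a natural number variable. -/
abbrev setN (a : ℕ) (e : NExp) : Prog := .setNat a (.lit 0) e

/-- Assignment to a real variable. -/
abbrev setR (a : ℕ) (e : RExp) : Prog := .setReal a (.lit 0) e

/-- Increment of a natural number variable. -/
abbrev incr (a : ℕ) : Prog := setN a (.add (nv a) (.lit 1))

/-- Execute `p` for the values `0, 1, …` of the variable `a` below that of the variable `b`. -/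
def forRange (a b : ℕ) (p : Prog) : Prog :=
  setN a (.lit 0) ;; .loop (.natLt (nv a) (nv b)) (p ;; incr a)

theorem Runs.forRange {a b n W : ℕ} {p : Prog} {s : State} (J : ℕ → State → Prop)
    (hb : s.nat b 0 = n) (h₀ : J 0 (s.setNat a 0 0))
    (hstep : ∀ i s', Frame (RealRAM.forRange a b p) s s' → i < n → s'.nat a 0 = i → J i s' →
      Runs p s' W fun s'' => J (i + 1) (s''.setNat a 0 (i + 1)))
    (ha : a ∉ p.natWrites := by decide) (hbp : b ∉ a :: p.natWrites := by decide)
    (hW : 0 < W := by positivity) :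
    Runs (RealRAM.forRange a b p) s ((n + 1) * W) (J n) := by
  have hba : b ≠ a := fun h => hbp (h ▸ List.mem_cons_self)
  have hmem : ∀ c, c ∈ (p ;; incr a).natWrites → c ∈ (RealRAM.forRange a b p).natWrites :=
    fun c hc => List.mem_cons_of_mem _ hc
  refine straight_seq rfl fun hinit => Runs.loop
    (fun m s' => ∃ i, i + m = n ∧ s'.nat a 0 = i ∧ J i s') n
    ⟨0, by omega, by simp [Prog.eff, NExp.eval], h₀⟩ ?_ ?_ hW
  all_goals
    rintro m s' hF ⟨i, rfl, hi, hJ⟩ hlt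
    have hF' := (hinit.mono (q := RealRAM.forRange a b p)
      (by simp [RealRAM.forRange, Prog.natWrites]) (by simp [Prog.realWrites])).trans
        (hF.mono hmem fun _ h => h)
    have hbs : s'.nat b 0 = i + m := by
      rw [hF.nat b 0 (by simpa [Prog.natWrites, hba] using hbp)]
      simpa [Prog.eff, NExp.eval, hba] using hb
    simp only [BExp.eval, NExp.eval, hi, hbs] at hlt
  · obtain ⟨k, rfl⟩ : ∃ k, m = k + 1 := ⟨m - 1, by omega⟩
    refine ⟨k, rfl, (hstep i s' hF' (by omega) hi hJ).seq fun s'' hF'' hJ' => ?_⟩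
    have hi' : s''.nat a 0 = i := (hF''.nat a 0 ha).trans hi
    refine .straight rfl ⟨i + 1, by omega, ?_, ?_⟩ <;> simp_all [Prog.eff, NExp.eval]
  · obtain rfl : m = 0 := by omega
    exact hJ

open TwoCenter (Plane)

attribute [simp] NExp.eval RExp.eval BExp.eval Prog.eff

/-- The vector stored in the cells `i` of the consecutive real arrays `a` and `a + 1`. -/
noncomputable def State.vec (s : State) (a i : ℕ) : Plane := !₂[s.real a i, s.real (a + 1) i]

/-- Write the vector `v` to the cells `i` of the real arrays `a` and `a + 1`. -/
def State.setVec (s : State) (a i : ℕ) (v : Plane) : State :=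
  (s.setReal a i (v 0)).setReal (a + 1) i (v 1)

theorem Frame.vec {p : Prog} {s s' : State} (h : Frame p s s') (a i : ℕ)
    (ha : a ∉ p.realWrites := by decide) (ha' : a + 1 ∉ p.realWrites := by decide) :
    s'.vec a i = s.vec a i := by
  rw [State.vec, State.vec, h.real a i ha, h.real (a + 1) i ha']

section VecAccessors

variable (s : State) {a i a' i' : ℕ} (v : Plane)

@[simp] theorem vec_setNat (k : ℕ) : (s.setNat a i k).vec a' i' = s.vec a' i' := rfl

@[simp] theorem vec_setReal (x : ℝ) (h : a' ≠ a) (h' : a' + 1 ≠ a) :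
    (s.setReal a i x).vec a' i' = s.vec a' i' := by simp [State.vec, h, h']

@[simp] theorem vec_setVec_self :
    (s.setVec a i v).vec a i' = if i' = i then v else s.vec a i' := by
  split_ifs with h <;> ext k <;> fin_cases k <;> simp [State.vec, State.setVec, h]

@[simp] theorem vec_setVec_of_ne (h : a' ≠ a) (h₁ : a' + 1 ≠ a) (h₂ : a' ≠ a + 1) :
    (s.setVec a i v).vec a' i' = s.vec a' i' := by simp [State.vec, State.setVec, h, h₁, h₂]

@[simp] theorem setVec_real_of_ne (h : a' ≠ a) (h₁ : a' ≠ a + 1) :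
    (s.setVec a i v).real a' i' = s.real a' i' := by simp [State.setVec, h, h₁]

@[simp] theorem setVec_nat : (s.setVec a i v).nat = s.nat := rfl

end VecAccessors

/-- Vector expressions, given by the two coordinates. -/
structure VExp where
  x : RExp
  y : RExp

namespace VExp

/-- The value of a vector expression. -/
noncomputable def eval (s : State) (e : VExp) : Plane := !₂[e.x.eval s, e.y.eval s]

/-- The vector expression reading the cells `i` of the real arrays `a` and `a + 1`. -/
def cell (a : ℕ) (i : NExp) : VExp := ⟨.cell a i, .cell (a + 1) i⟩

/-- The sum of two vector expressions. -/
def add (e f : VExp) : VExp := ⟨.add e.x f.x, .add e.y f.y⟩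

/-- The difference of two vector expressions. -/
def sub (e f : VExp) : VExp := ⟨.sub e.x f.x, .sub e.y f.y⟩

/-- The product of a scalar and a vector expression. -/
def smul (k : RExp) (e : VExp) : VExp := ⟨.mul k e.x, .mul k e.y⟩

/-- The inner product of two vector expressions. -/
def inner (e f : VExp) : RExp := .add (.mul e.x f.x) (.mul e.y f.y)

/-- The Euclidean norm of a vector expression. -/
def norm (e : VExp) : RExp := .sqrt (e.inner e)

/-- The Euclidean distance of two vector expressions. -/
def dist (e f : VExp) : RExp := (e.sub f).norm

variable (s : State) (e f : VExp)

@[simp] theorem eval_cell (a : ℕ) (i : NExp) : (cell a i).eval s = s.vec a (i.eval s) := rfl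

@[simp] theorem eval_add : (e.add f).eval s = e.eval s + f.eval s := by
  ext k; fin_cases k <;> simp [eval, add]

@[simp] theorem eval_sub : (e.sub f).eval s = e.eval s - f.eval s := by
  ext k; fin_cases k <;> simp [eval, sub]

@[simp] theorem eval_smul (k : RExp) : (smul k e).eval s = k.eval s • e.eval s := by
  ext k; fin_cases k <;> simp [eval, smul]

@[simp] theorem eval_inner : (e.inner f).eval s = Inner.inner ℝ (e.eval s) (f.eval s) := by
  simp [eval, inner, PiLp.inner_apply, mul_comm]

@[simp] theorem eval_norm : e.norm.eval s = ‖e.eval s‖ := by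
  simp only [norm, RExp.eval, eval_inner, norm_eq_sqrt_real_inner]

@[simp] theorem eval_dist : (e.dist f).eval s = Dist.dist (e.eval s) (f.eval s) := by
  simp [dist, dist_eq_norm]

end VExp

/-- The real arrays an expression reads. -/
def RExp.reads : RExp → List ℕ
  | .lit _ => []
  | .cell a _ => [a]
  | .add e f | .sub e f | .mul e f | .div e f => e.reads ++ f.reads
  | .sqrt e => e.reads

theorem NExp.eval_setReal (s : State) (a i : ℕ) (v : ℝ) (e : NExp) :
    e.eval (s.setReal a i v) = e.eval s := by
  induction e <;> simp_all

theorem RExp.eval_setReal {e : RExp} {a : ℕ} (h : a ∉ e.reads) (s : State) (i : ℕ) (v : ℝ) :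
    e.eval (s.setReal a i v) = e.eval s := by
  induction e <;> simp_all [reads, NExp.eval_setReal, eq_comm]

/-- The vector variable in the cells `0` of the arrays `a` and `a + 1`. -/
abbrev vv (a : ℕ) : VExp := .cell a (.lit 0)

/-- Assignment to the cells `i` of the real arrays `a` and `a + 1`. Since the two coordinates are
assigned one after the other, the second one should not depend on the array `a`. -/
def setVec (a : ℕ) (i : NExp) (e : VExp) : Prog := .setReal a i e.x ;; .setReal (a + 1) i e.y

/-- Assignment to a vector variable. -/
abbrev setV (a : ℕ) (e : VExp) : Prog := setVec a (.lit 0) e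

@[simp] theorem eff_setVec (a : ℕ) (i : NExp) (e : VExp) (s : State) (h : a ∉ e.y.reads) :
    (setVec a i e).eff s = s.setVec a (i.eval s) (e.eval s) := by
  simp [setVec, State.setVec, VExp.eval, NExp.eval_setReal, RExp.eval_setReal h]

end RealRAM

namespace TwoCenter

open RealRAM Metric
open scoped RealInnerProductSpace

/-! ### Covers and splits -/

section Covers

variable {X ι : Type*} [PseudoMetricSpace X] {c : ι → X} {r : ι → ℝ} {p₁ p₂ : X} {R : ℝ}

/-- The balls `closedBall (c i) (r i)` are each contained in `closedBall p₁ R` or in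
`closedBall p₂ R`, expressed by the distances of the centers. -/
def Covers (c : ι → X) (r : ι → ℝ) (p₁ p₂ : X) (R : ℝ) : Prop :=
  ∀ i, dist p₁ (c i) + r i ≤ R ∨ dist p₂ (c i) + r i ≤ R

theorem Covers.symm (h : Covers c r p₁ p₂ R) : Covers c r p₂ p₁ R := fun i => (h i).symm

theorem Covers.nonneg [Nonempty ι] (hr : ∀ i, 0 ≤ r i) (h : Covers c r p₁ p₂ R) : 0 ≤ R := by
  obtain ⟨i⟩ := ‹Nonempty ι›
  exact (h i).elim (add_nonneg dist_nonneg (hr i)).trans (add_nonneg dist_nonneg (hr i)).trans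

/-- Two of the balls `a`, `b` and `i` lie in the same ball of the given cover. -/
theorem Covers.two_mul_of_farthest (hr : ∀ i, 0 ≤ r i) {a b : ι}
    (hb : ∀ i, dist (c i) (c a) + r i ≤ dist (c b) (c a) + r b) (h : Covers c r p₁ p₂ R) :
    Covers c r (c a) (c b) (2 * R) := by
  have near : ∀ i k p, dist p (c i) + r i ≤ R → dist p (c k) + r k ≤ R →
      dist (c i) (c k) + r i ≤ 2 * R := fun i k p hi hk => by
    linarith [dist_triangle_left (c i) (c k) p, hr k]
  intro i
  rw [dist_comm (c a), dist_comm (c b)]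
  have := hb i
  rcases h i with hi | hi <;> rcases h a with ha | ha <;> rcases h b with hb | hb <;>
  first
  | exact .inl (near i a _ hi ha)
  | exact .inr (near i b _ hi hb)
  | exact .inl (this.trans (near b a _ hb ha))

end Covers

theorem closedBall_subset_closedBall_iff {E : Type*} [NormedAddCommGroup E] [NormedSpace ℝ E]
    [Nontrivial E] {c p : E} {r R : ℝ} (hr : 0 ≤ r) :
    closedBall c r ⊆ closedBall p R ↔ dist p c + r ≤ R := by
  refine ⟨fun h => ?_, fun h => closedBall_subset_closedBall' (by rw [dist_comm]; linarith)⟩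
  obtain ⟨v, hv, hcv⟩ : ∃ v : E, ‖v‖ = 1 ∧ c - p = ‖c - p‖ • v := by
    rcases eq_or_ne c p with rfl | hne
    · obtain ⟨v, hv⟩ := exists_norm_eq E zero_le_one
      exact ⟨v, hv, by simp⟩
    · have hne' : ‖c - p‖ ≠ 0 := norm_ne_zero_iff.2 (sub_ne_zero.2 hne)
      exact ⟨‖c - p‖⁻¹ • (c - p), by simp [norm_smul, hne'], by simp [smul_smul, hne']⟩
  have hfar : c + r • v - p = (‖c - p‖ + r) • v := by
    rw [add_smul, ← hcv]
    abel
  have hmem := h (show c + r • v ∈ closedBall c r by simp [norm_smul, hv, abs_of_nonneg hr])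
  rwa [mem_closedBall, dist_eq_norm, hfar, norm_smul, hv, mul_one,
    Real.norm_of_nonneg (by positivity), ← dist_eq_norm, dist_comm] at hmem

section Split

variable {E ι : Type*} [NormedAddCommGroup E] [InnerProductSpace ℝ E] {c : ι → E} {r : ι → ℝ}
  {p₁ p₂ : E} {R : ℝ}

/-- The points `c i` with `i ∈ S` come strictly before all others in the direction `u`. -/
def IsPrefix (c : ι → E) (u : E) (S : Set ι) : Prop := ∀ i ∈ S, ∀ j ∉ S, ⟪u, c i⟫ < ⟪u, c j⟫

theorem IsPrefix.compl {u : E} {S : Set ι} (h : IsPrefix c u S) : IsPrefix c (-u) Sᶜ :=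
  fun i hi j hj => by
    simpa only [inner_neg_left, neg_lt_neg_iff] using h j (not_not.1 hj) i hi

/-- The balls `closedBall (c i) (r i)` are covered by two balls of radius `R` such that a
hyperplane orthogonal to `u` separates the centers assigned to the first ball from the others. -/
def HasSplit (c : ι → E) (r : ι → ℝ) (u : E) (R : ℝ) : Prop :=
  ∃ (S : Set ι) (p₁ p₂ : E), IsPrefix c u S ∧ (∀ i ∈ S, dist p₁ (c i) + r i ≤ R) ∧
    ∀ i ∉ S, dist p₂ (c i) + r i ≤ R

theorem HasSplit.mono {u : E} {R' : ℝ} (h : HasSplit c r u R) (hR : R ≤ R') :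
    HasSplit c r u R' := by
  obtain ⟨S, p₁, p₂, hS, h₁, h₂⟩ := h
  exact ⟨S, p₁, p₂, hS, fun i hi => (h₁ i hi).trans hR, fun i hi => (h₂ i hi).trans hR⟩

theorem dist_sq_sub_dist_sq (p₁ p₂ x : E) :
    dist p₁ x ^ 2 - dist p₂ x ^ 2 = 2 * ⟪p₂ - p₁, x - midpoint ℝ p₁ p₂⟫ := by
  have h₁ : p₁ - x = -((x - midpoint ℝ p₁ p₂) + (1 / 2 : ℝ) • (p₂ - p₁)) := by
    rw [midpoint_eq_smul_add, invOf_eq_inv]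
    module
  have h₂ : p₂ - x = -((x - midpoint ℝ p₁ p₂) - (1 / 2 : ℝ) • (p₂ - p₁)) := by
    rw [midpoint_eq_smul_add, invOf_eq_inv]
    module
  rw [dist_eq_norm, dist_eq_norm, h₁, h₂, norm_neg, norm_neg, norm_add_sq_real,
    norm_sub_sq_real (x - midpoint ℝ p₁ p₂), inner_smul_right, real_inner_comm]
  ring

theorem dist_le_dist_of_inner_nonpos {x : E} (h : ⟪p₂ - p₁, x - midpoint ℝ p₁ p₂⟫ ≤ 0) :
    dist p₁ x ≤ dist p₂ x :=
  le_of_sq_le_sq (by linarith [dist_sq_sub_dist_sq p₁ p₂ x]) dist_nonneg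

theorem Covers.hasSplit_of_inner_pos (h : Covers c r p₁ p₂ R) {w : E}
    (hw : ∀ i j, 0 < ⟪p₂ - p₁, c i - c j⟫ → 0 < ⟪w, c i - c j⟫) : HasSplit c r w R := by
  refine ⟨{i | ⟪p₂ - p₁, c i - midpoint ℝ p₁ p₂⟫ ≤ 0}, p₁, p₂, fun i hi j hj => ?_,
    fun i hi => ?_, fun i hi => ?_⟩
  · have hpos := hw j i (by simp only [Set.mem_ofPred_eq, inner_sub_right] at hi hj ⊢; linarith)
    rw [inner_sub_right] at hpos
    linarith
  · have := dist_le_dist_of_inner_nonpos hi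
    rcases h i with h | h <;> linarith
  · have : dist p₂ (c i) ≤ dist p₁ (c i) := by
      refine dist_le_dist_of_inner_nonpos ?_
      rw [← neg_sub p₂ p₁, inner_neg_left, midpoint_comm]
      exact neg_nonpos.2 (not_le.1 hi).le
    rcases h i with h | h <;> linarith

section Wedge

variable {x u v : E} {l h R ρ : ℝ}

theorem dist_le_dist_add_of_near (hl : 0 ≤ l) (hp : p₂ - p₁ = l • u) (hu : 1 ≤ ‖u‖)
    (hv : ‖v - u‖ ≤ h) (hnear : dist p₁ p₂ ≤ 4 * R) (hR : dist p₂ x ≤ R)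
    (hx : ⟪v, x - midpoint ℝ p₁ p₂⟫ ≤ 0) : dist p₁ x ≤ dist p₂ x + 6 * h * R := by
  have hh₀ : 0 ≤ h := (norm_nonneg _).trans hv
  have hRh : 0 ≤ h * R := mul_nonneg hh₀ (dist_nonneg.trans hR)
  have hinner : ⟪u, x - midpoint ℝ p₁ p₂⟫ ≤ h * (3 * R) := by
    have hdist : ‖x - midpoint ℝ p₁ p₂‖ ≤ 3 * R := by
      have hmid : dist p₂ (midpoint ℝ p₁ p₂) = 1 / 2 * dist p₁ p₂ := by simp
      rw [← dist_eq_norm]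
      linarith [dist_triangle_left x (midpoint ℝ p₁ p₂) p₂]
    calc ⟪u, x - midpoint ℝ p₁ p₂⟫
        = ⟪v, x - midpoint ℝ p₁ p₂⟫ + ⟪u - v, x - midpoint ℝ p₁ p₂⟫ := by
          rw [← inner_add_left, add_sub_cancel]
      _ ≤ 0 + ‖u - v‖ * ‖x - midpoint ℝ p₁ p₂‖ := add_le_add hx (real_inner_le_norm _ _)
      _ ≤ h * (3 * R) := by
          rw [zero_add, norm_sub_rev]
          gcongr
  by_contra! hlt
  have hlen : l ≤ dist p₁ x + dist p₂ x := by
    have : dist p₁ p₂ = l * ‖u‖ := by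
      rw [dist_comm, dist_eq_norm, hp, norm_smul, Real.norm_of_nonneg hl]
    nlinarith [dist_triangle_right p₁ p₂ x]
  have hprod : (dist p₁ x - dist p₂ x) * (dist p₁ x + dist p₂ x) ≤
      6 * h * R * (dist p₁ x + dist p₂ x) :=
    calc (dist p₁ x - dist p₂ x) * (dist p₁ x + dist p₂ x)
        = 2 * (l * ⟪u, x - midpoint ℝ p₁ p₂⟫) := by
          rw [← real_inner_smul_left, ← hp, ← dist_sq_sub_dist_sq]
          ring
      _ ≤ 2 * (l * (h * (3 * R))) := by gcongr
      _ = 6 * h * R * l := by ring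
      _ ≤ 6 * h * R * (dist p₁ x + dist p₂ x) := mul_le_mul_of_nonneg_left hlen (by linarith)
  have hpos : 0 < dist p₁ x + dist p₂ x := by linarith [dist_nonneg (x := p₂) (y := x)]
  linarith [le_of_mul_le_mul_right hprod hpos]

theorem inner_pos_of_far (hl : 0 ≤ l) (hp : p₂ - p₁ = l • u) (hu : 1 ≤ ‖u‖) (hv : ‖v - u‖ ≤ h)
    (hh : h ≤ 1 / 3) (hfar : 4 * R < dist p₁ p₂) (hR : dist p₂ x ≤ R) :
    0 < ⟪v, x - midpoint ℝ p₁ p₂⟫ := by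
  have hR₀ : 0 ≤ R := dist_nonneg.trans hR
  have hlen : dist p₁ p₂ = l * ‖u‖ := by
    rw [dist_comm, dist_eq_norm, hp, norm_smul, Real.norm_of_nonneg hl]
  have hsplit : x - midpoint ℝ p₁ p₂ = (x - p₂) + (l / 2) • u := by
    rw [show (l / 2) • u = (1 / 2 : ℝ) • (p₂ - p₁) by rw [hp]; module, midpoint_eq_smul_add,
      invOf_eq_inv]
    module
  have hvx : -(R * (‖u‖ + h)) ≤ ⟪v, x - p₂⟫ := by
    have hvn : ‖v‖ ≤ ‖u‖ + h := by linarith [norm_le_norm_add_norm_sub' v u]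
    have hxn : ‖x - p₂‖ ≤ R := by rwa [← dist_eq_norm, dist_comm]
    have := neg_le_of_abs_le (abs_real_inner_le_norm v (x - p₂))
    nlinarith [norm_nonneg v, norm_nonneg u]
  have hvu : ‖u‖ * (‖u‖ - h) ≤ ⟪v, u⟫ := by
    have hsum : ⟪v, u⟫ = ⟪v - u, u⟫ + ‖u‖ ^ 2 := by
      rw [← real_inner_self_eq_norm_sq, ← inner_add_left, sub_add_cancel]
    have := neg_le_of_abs_le (abs_real_inner_le_norm (v - u) u)
    nlinarith [norm_nonneg u]
  rw [hsplit, inner_add_right, real_inner_smul_right]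
  have hpos : 0 < ‖u‖ - h := by linarith
  nlinarith [mul_le_mul_of_nonneg_left hvu hl, mul_pos (sub_pos.2 hfar) hpos]

theorem dist_add_le_of_inner_nonpos (hl : 0 ≤ l) (hp : p₂ - p₁ = l • u) (hu : 1 ≤ ‖u‖)
    (hv : ‖v - u‖ ≤ h) (hh : h ≤ 1 / 3) (hρ : 0 ≤ ρ)
    (hc : dist p₁ x + ρ ≤ R ∨ dist p₂ x + ρ ≤ R) (hx : ⟪v, x - midpoint ℝ p₁ p₂⟫ ≤ 0) :
    dist p₁ x + ρ ≤ (1 + 6 * h) * R := by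
  have hh₀ : 0 ≤ h := (norm_nonneg _).trans hv
  rcases hc with hc | hc
  · have hR₀ : 0 ≤ R := (add_nonneg dist_nonneg hρ).trans hc
    nlinarith
  · have hR : dist p₂ x ≤ R := by linarith
    rcases le_or_gt (dist p₁ p₂) (4 * R) with hnear | hfar
    · linarith [dist_le_dist_add_of_near hl hp hu hv hnear hR hx]
    · exact absurd hx (inner_pos_of_far hl hp hu hv hh hfar hR).not_ge

end Wedge

theorem Covers.hasSplit_of_close (hr : ∀ i, 0 ≤ r i) (hcov : Covers c r p₁ p₂ R) {u v : E}
    {l h : ℝ} (hl : 0 ≤ l) (hp : p₂ - p₁ = l • u) (hu : 1 ≤ ‖u‖) (hv : ‖v - u‖ ≤ h)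
    (hh : h ≤ 1 / 3) : HasSplit c r v ((1 + 6 * h) * R) := by
  refine ⟨{i | ⟪v, c i - midpoint ℝ p₁ p₂⟫ ≤ 0}, p₁, p₂, fun i hi j hj => ?_, fun i hi => ?_,
    fun i hi => ?_⟩
  · simp only [Set.mem_ofPred_eq, inner_sub_right, not_le] at hi hj
    linarith
  · exact dist_add_le_of_inner_nonpos hl hp hu hv hh (hr i) (hcov i) hi
  · refine dist_add_le_of_inner_nonpos (u := -u) (v := -v) hl ?_ ?_ ?_ hh (hr i) (hcov i).symm ?_
    · rw [smul_neg, ← hp, neg_sub]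
    · rwa [norm_neg]
    · rwa [← neg_sub', norm_neg]
    · rw [inner_neg_left, midpoint_comm]
      exact neg_nonpos.2 (not_le.1 hi).le

end Split

/-! ### Directions of a net -/

section Net

variable {ι : Type*} {c : ι → Plane} {r : ι → ℝ} {p₁ p₂ : Plane} {R : ℝ}

theorem exists_smul_eq_or (w : Plane) : ∃ l s : ℝ, |s| ≤ 1 ∧
    (w = l • !₂[1, s] ∨ w = l • !₂[s, 1]) := by
  have key : ∀ a b : ℝ, |b| ≤ |a| → ∃ s, |s| ≤ 1 ∧ b = a * s := fun a b hab => by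
    rcases eq_or_ne a 0 with rfl | ha
    · exact ⟨0, by simp, by simpa using hab⟩
    · exact ⟨b / a, by rwa [abs_div, div_le_one (abs_pos.2 ha)], by field_simp⟩
  rcases le_total |w 1| |w 0| with h | h
  · obtain ⟨s, hs, hw⟩ := key _ _ h
    exact ⟨w 0, s, hs, .inl (by ext k; fin_cases k <;> simp [hw])⟩
  · obtain ⟨s, hs, hw⟩ := key _ _ h
    exact ⟨w 1, s, hs, .inr (by ext k; fin_cases k <;> simp [hw])⟩

theorem Covers.exists_hasSplit_of_net (hr : ∀ i, 0 ≤ r i) (hcov : Covers c r p₁ p₂ R) {h : ℝ}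
    (hh : h ≤ 1 / 3) {net : Set ℝ} (hnet : ∀ s : ℝ, |s| ≤ 1 → ∃ s' ∈ net, |s' - s| ≤ h) :
    ∃ s ∈ net, HasSplit c r !₂[1, s] ((1 + 6 * h) * R) ∨
      HasSplit c r !₂[s, 1] ((1 + 6 * h) * R) := by
  obtain ⟨l, s, hs, hp⟩ := exists_smul_eq_or (p₂ - p₁)
  wlog hl : 0 ≤ l generalizing l p₁ p₂
  · refine this hcov.symm (-l) (hp.imp ?_ ?_) (by linarith) <;>
    exact fun hp => by rw [neg_smul, ← hp, neg_sub]
  obtain ⟨s', hs', hd⟩ := hnet s hs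
  refine ⟨s', hs', hp.imp (fun hp => ?_) fun hp => ?_⟩
  all_goals
    refine hcov.hasSplit_of_close hr hl hp ?_ ?_ hh
    · rw [EuclideanSpace.norm_eq, Real.one_le_sqrt]
      simp [sq_nonneg]
    · simpa [EuclideanSpace.norm_eq, Real.sqrt_sq_eq_abs] using hd

end Net

/-! ### Bisectors -/

theorem inner_bisector_pos {E : Type*} [NormedAddCommGroup E] [InnerProductSpace ℝ E] {u a b : E}
    (ha : 0 < ⟪u, a⟫) (hb : 0 < ⟪u, b⟫) : 0 < ⟪‖b‖ • a + ‖a‖ • b, a⟫ := by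
  have ne_zero : ∀ v : E, 0 < ⟪u, v⟫ → 0 < ‖v‖ := fun v hv =>
    norm_pos_iff.2 fun h => by simp [h] at hv
  have hne : ⟪-a, b⟫ ≠ ‖-a‖ * ‖b‖ := fun h => by
    have := congrArg (⟪u, ·⟫) (inner_eq_norm_mul_iff_real.1 h)
    simp only [smul_neg, inner_neg_right, real_inner_smul_right, norm_neg] at this
    linarith [mul_pos (ne_zero a ha) hb, mul_pos (ne_zero b hb) ha]
  have hlt := lt_of_le_of_ne (real_inner_le_norm (-a) b) hne
  rw [inner_neg_left, norm_neg, real_inner_comm] at hlt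
  rw [inner_add_left, real_inner_smul_left, real_inner_smul_left, real_inner_self_eq_norm_sq]
  nlinarith [ne_zero a ha]

/-- The rotation of the plane by a right angle. -/
noncomputable def rot (u : Plane) : Plane := !₂[-u 1, u 0]

theorem norm_sq_smul_eq (u v : Plane) : ‖u‖ ^ 2 • v = ⟪u, v⟫ • u + ⟪rot u, v⟫ • rot u := by
  ext k
  fin_cases k <;> simp [rot, EuclideanSpace.norm_sq_eq, PiLp.inner_apply, Fin.sum_univ_two] <;> ring

/-- The two vectors are those whose slope relative to `u` is extreme. -/
theorem exists_forall_eq_smul_add_smul {V : Set Plane} (hfin : V.Finite) (hne : V.Nonempty)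
    {u : Plane} (hu : ∀ v ∈ V, 0 < ⟪u, v⟫) :
    ∃ a ∈ V, ∃ b ∈ V, ∀ v ∈ V, ∃ x y : ℝ, 0 ≤ x ∧ 0 ≤ y ∧ v = x • a + y • b := by
  let slope : Plane → ℝ := fun v => ⟪rot u, v⟫ / ⟪u, v⟫
  obtain ⟨a, ha, hamin⟩ := V.exists_min_image slope hfin hne
  obtain ⟨b, hb, hbmax⟩ := V.exists_max_image slope hfin hne
  refine ⟨a, ha, b, hb, fun v hv => ?_⟩
  have hu₀ : ‖u‖ ^ 2 ≠ 0 := pow_ne_zero 2 (norm_ne_zero_iff.2 fun h => by simp [h] at hu; tauto)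
  have decomp : ∀ w ∈ V, ‖u‖ ^ 2 • w = ⟪u, w⟫ • (u + slope w • rot u) := fun w hw => by
    rw [norm_sq_smul_eq, smul_add, smul_smul, mul_div_cancel₀ _ (hu w hw).ne']
  obtain ⟨x, y, hx, hy, hxy, hslope⟩ : slope v ∈ segment ℝ (slope a) (slope b) := by
    rw [segment_eq_Icc (hamin b hb)]
    exact ⟨hamin v hv, hbmax v hv⟩
  have hpos := hu v hv
  have hposa := hu a ha
  have hposb := hu b hb
  refine ⟨⟪u, v⟫ * x / ⟪u, a⟫, ⟪u, v⟫ * y / ⟪u, b⟫, by positivity, by positivity, ?_⟩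
  refine smul_right_injective _ hu₀ ?_
  calc ‖u‖ ^ 2 • v = ⟪u, v⟫ • (u + (x • slope a + y • slope b) • rot u) := by
        rw [decomp v hv, hslope]
    _ = (⟪u, v⟫ * x) • (u + slope a • rot u) + (⟪u, v⟫ * y) • (u + slope b • rot u) := by
      rw [eq_sub_of_add_eq' hxy]
      simp only [smul_eq_mul]
      module
    _ = (⟪u, v⟫ * x / ⟪u, a⟫) • ‖u‖ ^ 2 • a + (⟪u, v⟫ * y / ⟪u, b⟫) • ‖u‖ ^ 2 • b := by
      rw [decomp a ha, decomp b hb, smul_smul, smul_smul, div_mul_cancel₀ _ hposa.ne',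
        div_mul_cancel₀ _ hposb.ne']
    _ = ‖u‖ ^ 2 • ((⟪u, v⟫ * x / ⟪u, a⟫) • a + (⟪u, v⟫ * y / ⟪u, b⟫) • b) := by module

theorem exists_forall_inner_bisector_pos {V : Set Plane} (hfin : V.Finite) (hne : V.Nonempty)
    {u : Plane} (hu : ∀ v ∈ V, 0 < ⟪u, v⟫) :
    ∃ a ∈ V, ∃ b ∈ V, ∀ v ∈ V, 0 < ⟪‖b‖ • a + ‖a‖ • b, v⟫ := by
  obtain ⟨a, ha, b, hb, hcone⟩ := exists_forall_eq_smul_add_smul hfin hne hu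
  refine ⟨a, ha, b, hb, fun v hv => ?_⟩
  obtain ⟨x, y, hx, hy, rfl⟩ := hcone v hv
  have hwa := inner_bisector_pos (hu a ha) (hu b hb)
  have hwb := inner_bisector_pos (hu b hb) (hu a ha)
  rw [add_comm] at hwb
  have hpos := hu _ hv
  simp only [inner_add_right, real_inner_smul_right] at hpos ⊢
  rcases hx.eq_or_lt with rfl | hx
  · have hy : 0 < y := hy.lt_of_ne (by rintro rfl; simp at hpos)
    simpa using mul_pos hy hwb
  · exact add_pos_of_pos_of_nonneg (mul_pos hx hwa) (mul_nonneg hy hwb.le)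

theorem Covers.exists_hasSplit_bisector {ι : Type*} [Finite ι] [Nonempty ι] {c : ι → Plane}
    {r : ι → ℝ} {p₁ p₂ : Plane} {R : ℝ} (h : Covers c r p₁ p₂ R) :
    ∃ i j k l, HasSplit c r (‖c k - c l‖ • (c i - c j) + ‖c i - c j‖ • (c k - c l)) R := by
  let V : Set Plane := {v | 0 < ⟪p₂ - p₁, v⟫} ∩ Set.range fun ij : ι × ι => c ij.1 - c ij.2
  rcases V.eq_empty_or_nonempty with hV | hV
  · obtain ⟨i⟩ := ‹Nonempty ι›
    refine ⟨i, i, i, i, h.hasSplit_of_inner_pos fun j k hjk => ?_⟩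
    exact absurd ⟨hjk, (j, k), rfl⟩ (Set.eq_empty_iff_forall_notMem.1 hV (c j - c k))
  · obtain ⟨_, ⟨-, ⟨i, j⟩, rfl⟩, _, ⟨-, ⟨k, l⟩, rfl⟩, hpos⟩ :=
      exists_forall_inner_bisector_pos ((Set.finite_range _).inter_of_right _) hV
        fun v hv => hv.1
    exact ⟨i, j, k, l, h.hasSplit_of_inner_pos fun j k hjk => hpos _ ⟨hjk, (j, k), rfl⟩⟩

/-! ### The ellipsoid method in the plane -/

/-- The ellipse with center `q` and conjugate semi-axes `a` and `b`, that is, the image of the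
closed unit disk under `(x, y) ↦ q + (x • a + y • b)`. -/
def ellipse {E : Type*} [AddCommGroup E] [Module ℝ E] (q a b : E) : Set E :=
  {p | ∃ x y : ℝ, x ^ 2 + y ^ 2 ≤ 1 ∧ p = q + (x • a + y • b)}

/-- Rotating the conjugate axes by `α` and `β` turns the half-plane into `t ≤ 0`, and the half disk
`s ^ 2 + t ^ 2 ≤ 1`, `t ≤ 0` lies in the image of the unit disk under
`(t, s) ↦ (2 / 3 * t - 1 / 3, 7 / 6 * s)`. -/
theorem mem_ellipse_cut {E : Type*} [NormedAddCommGroup E] [InnerProductSpace ℝ E]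
    {q a b p g : E} {α β ν : ℝ} (h : p ∈ ellipse q a b) (hν : 0 < ν) (hαβ : α ^ 2 + β ^ 2 = 1)
    (hα : ⟪g, a⟫ = ν * α) (hβ : ⟪g, b⟫ = ν * β) (hg : ⟪g, p - q⟫ ≤ 0) :
    p ∈ ellipse (q - (1 / 3 : ℝ) • (α • a + β • b)) ((2 / 3 : ℝ) • (α • a + β • b))
      ((7 / 6 : ℝ) • (α • b - β • a)) := by
  obtain ⟨x, y, hxy, rfl⟩ := h
  obtain ⟨t, ht⟩ : ∃ t, t = α * x + β * y := ⟨_, rfl⟩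
  obtain ⟨s, hs⟩ : ∃ s, s = α * y - β * x := ⟨_, rfl⟩
  have hx : x = α * t - β * s := by rw [ht, hs]; linear_combination (-x) * hαβ
  have hy : y = β * t + α * s := by rw [ht, hs]; linear_combination (-y) * hαβ
  have hts : t ^ 2 + s ^ 2 ≤ 1 := by
    rw [ht, hs]; linear_combination hxy + (x ^ 2 + y ^ 2) * hαβ
  have ht₀ : t ≤ 0 := by
    rw [add_sub_cancel_left, inner_add_right, real_inner_smul_right, real_inner_smul_right, hα,
      hβ] at hg
    refine nonpos_of_mul_nonpos_right (a := ν) ?_ hν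
    rw [ht]
    linarith
  have ht₁ : -1 ≤ t := by nlinarith
  refine ⟨3 / 2 * t + 1 / 2, 6 / 7 * s, ?_, ?_⟩
  · nlinarith [mul_nonneg (neg_nonneg.2 ht₀) (show 0 ≤ t + 1 by linarith), sq_nonneg s]
  · rw [hx, hy]
    module

theorem inner_sub_nonpos_of_dist_le {E : Type*} [NormedAddCommGroup E] [InnerProductSpace ℝ E]
    {p q x : E} (h : dist p x ≤ dist q x) : ⟪q - x, p - q⟫ ≤ 0 := by
  have hsq := pow_le_pow_left₀ dist_nonneg h 2
  rw [dist_eq_norm, dist_eq_norm, show p - x = (q - x) + (p - q) by abel, norm_add_sq_real] at hsq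
  nlinarith [sq_nonneg ‖p - q‖]

/-- The cross product of two vectors of the plane; up to the factor `π`, its absolute value is the
area of the ellipse with the conjugate semi-axes `a` and `b`. -/
def cross (a b : Plane) : ℝ := a 0 * b 1 - a 1 * b 0

theorem cross_cut (a b : Plane) {α β : ℝ} (hαβ : α ^ 2 + β ^ 2 = 1) :
    cross ((2 / 3 : ℝ) • (α • a + β • b)) ((7 / 6 : ℝ) • (α • b - β • a)) = 7 / 9 * cross a b := by
  simp only [cross, PiLp.smul_apply, PiLp.add_apply, PiLp.sub_apply, smul_eq_mul]
  linear_combination (7 / 9 * (a 0 * b 1 - a 1 * b 0)) * hαβ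

theorem eq_zero_of_inner_eq_zero {a b g : Plane} (hab : cross a b ≠ 0) (ha : ⟪g, a⟫ = 0)
    (hb : ⟪g, b⟫ = 0) : g = 0 := by
  simp only [PiLp.inner_apply, Fin.sum_univ_two, RCLike.inner_apply, conj_trivial] at ha hb
  ext k
  refine (mul_eq_zero.1 (?_ : cross a b * g k = 0)).resolve_left hab
  fin_cases k <;> simp only [cross, Fin.zero_eta, Fin.mk_one]
  · linear_combination b 1 * ha - a 1 * hb
  · linear_combination a 0 * hb - b 0 * ha

theorem closedBall_subset_ellipse (q : Plane) {R : ℝ} (hR : 0 < R) :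
    closedBall q R ⊆ ellipse q !₂[R, 0] !₂[0, R] := by
  intro p hp
  refine ⟨(p 0 - q 0) / R, (p 1 - q 1) / R, ?_, ?_⟩
  · rw [mem_closedBall, EuclideanSpace.dist_eq, Real.sqrt_le_iff] at hp
    simp only [Fin.sum_univ_two, Real.dist_eq, sq_abs] at hp
    rw [div_pow, div_pow, ← add_div, div_le_one (by positivity)]
    exact hp.2
  · ext k
    fin_cases k <;> simp <;> field_simp <;> ring

theorem exists_eq_smul_add_smul_of_closedBall_subset {E : Type*} [NormedAddCommGroup E]
    [Module ℝ E] {q a b x d : E} {ρ : ℝ} (h : closedBall x ρ ⊆ ellipse q a b) (hd : ‖d‖ ≤ ρ) :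
    ∃ y z : ℝ, y ^ 2 + z ^ 2 ≤ 1 ∧ d = y • a + z • b := by
  obtain ⟨y, z, hyz, hplus⟩ := h (show x + d ∈ closedBall x ρ by simpa using hd)
  obtain ⟨y', z', hyz', hminus⟩ := h (show x - d ∈ closedBall x ρ by simpa using hd)
  refine ⟨(y - y') / 2, (z - z') / 2, by nlinarith [sq_nonneg (y + y'), sq_nonneg (z + z')], ?_⟩
  have hd : d = (1 / 2 : ℝ) • ((x + d) - (x - d)) := by module
  rw [hd, hplus, hminus]
  module

theorem sq_le_abs_cross_of_closedBall_subset {q a b x : Plane} {ρ : ℝ} (hρ : 0 ≤ ρ)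
    (h : closedBall x ρ ⊆ ellipse q a b) : ρ ^ 2 ≤ |cross a b| := by
  obtain ⟨y, z, hyz, hd⟩ := exists_eq_smul_add_smul_of_closedBall_subset h
    (d := !₂[ρ, 0]) (by simp [EuclideanSpace.norm_eq, Real.sqrt_sq hρ])
  obtain ⟨y', z', hyz', hd'⟩ := exists_eq_smul_add_smul_of_closedBall_subset h
    (d := !₂[0, ρ]) (by simp [EuclideanSpace.norm_eq, Real.sqrt_sq hρ])
  have hle : |y * z' - z * y'| ≤ 1 := by
    rw [abs_le]
    constructor
    · nlinarith only [hyz, hyz', sq_nonneg (y + z'), sq_nonneg (z - y')]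
    · nlinarith only [hyz, hyz', sq_nonneg (y - z'), sq_nonneg (z + y')]
  have hprod : ρ ^ 2 = cross a b * (y * z' - z * y') := by
    calc ρ ^ 2 = cross !₂[ρ, 0] !₂[0, ρ] := by simp [cross, pow_two]
      _ = cross (y • a + z • b) (y' • a + z' • b) := by rw [← hd, ← hd']
      _ = cross a b * (y * z' - z * y') := by simp [cross]; ring
  calc ρ ^ 2 = |cross a b| * |y * z' - z * y'| := by
        rw [← abs_mul, ← hprod, abs_of_nonneg (sq_nonneg ρ)]
    _ ≤ |cross a b| := mul_le_of_le_one_right (abs_nonneg _) hle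

/-! ### Memory layout

The natural number arrays, followed by the real arrays. Each vector occupies its array and the next
one. -/

namespace Reg

abbrev count : ℕ := 0
abbrev disk : ℕ := 1
abbrev violator : ℕ := 2
abbrev iteration : ℕ := 3
abbrev iterations : ℕ := 4
abbrev dirIndex : ℕ := 5
abbrev dirCount : ℕ := 6
abbrev uncovered : ℕ := 7
abbrev netSize : ℕ := 8
abbrev idx₁ : ℕ := 9
abbrev idx₂ : ℕ := 10
abbrev idx₃ : ℕ := 11
abbrev idx₄ : ℕ := 12

abbrev eps : ℕ := 0
abbrev center : ℕ := 1
abbrev radius : ℕ := 3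
abbrev output : ℕ := 4
abbrev dir : ℕ := 5
abbrev budget : ℕ := 7
abbrev query : ℕ := 8
abbrev proj : ℕ := 10
abbrev axisA : ℕ := 11
abbrev axisB : ℕ := 13
abbrev cosA : ℕ := 15
abbrev cosB : ℕ := 16
abbrev gradNorm : ℕ := 17
abbrev pole : ℕ := 18
abbrev bestCenter : ℕ := 20
abbrev bestProj : ℕ := 22
abbrev target : ℕ := 23
abbrev firstCenter : ℕ := 24
abbrev factor : ℕ := 26
abbrev best : ℕ := 27
abbrev cover₁ : ℕ := 28
abbrev cover₂ : ℕ := 30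
abbrev dirs : ℕ := 32
abbrev precision : ℕ := 34
abbrev slope : ℕ := 35
abbrev size : ℕ := 36

end Reg

open Reg

variable {n : ℕ} {c : Fin n → Plane} {r : Fin n → ℝ} {s s' s'' : State}

/-- The memory of the machine holds the disks with centers `c` and radii `r`. -/
structure Loaded (c : Fin n → Plane) (r : Fin n → ℝ) (s : State) : Prop where
  count : s.nat Reg.count 0 = n
  center : ∀ i : Fin n, s.vec Reg.center i = c i
  radius : ∀ i : Fin n, s.real Reg.radius i = r i

theorem Loaded.frame {p : Prog} (h : Loaded c r s) (hF : Frame p s s')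
    (hn : Reg.count ∉ p.natWrites := by decide) (h₁ : Reg.center ∉ p.realWrites := by decide)
    (h₂ : Reg.center + 1 ∉ p.realWrites := by decide)
    (h₃ : Reg.radius ∉ p.realWrites := by decide) : Loaded c r s' where
  count := (hF.nat _ _ hn).trans h.count
  center i := (hF.vec _ _ h₁ h₂).trans (h.center i)
  radius i := (hF.real _ _ h₃).trans (h.radius i)

/-- The radius of the smallest disk with the center stored in `a` that contains the disk number
`Reg.disk`. -/
def reachExp (a : ℕ) : RExp :=
  .add ((vv a).dist (.cell center (nv disk))) (.cell radius (nv disk))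

theorem eval_reachExp (h : Loaded c r s) {i : Fin n} (hi : s.nat disk 0 = i) (a : ℕ) :
    (reachExp a).eval s = dist (s.vec a 0) (c i) + r i := by
  simp [reachExp, hi, h.center, h.radius]

/-! ### Finding a violated disk -/

/-- The projection of the center of the disk number `Reg.disk` to the current direction. -/
def projExp : RExp := (vv dir).inner (.cell center (nv disk))

theorem eval_projExp (h : Loaded c r s) {i : Fin n} (hi : s.nat disk 0 = i) :
    projExp.eval s = ⟪s.vec dir 0, c i⟫ := by
  simp [projExp, hi, h.center]

/-- Among the disks that the disk of radius `Reg.budget` around `Reg.query` does not contain, find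
one whose projection is minimal. -/
def scan : Prog :=
  setN violator (nv count) ;;
  forRange disk count
    (.cond (.realLt (rv budget) (reachExp query))
      (.cond (.and (.natLt (nv violator) (nv count)) (.not (.realLt projExp (rv proj)))) .skip
        (setN violator (nv disk) ;; setR proj projExp))
      .skip)

/-- The result of `scan`, restricted to the first `k` disks. -/
def Scanned (c : Fin n → Plane) (r : Fin n → ℝ) (k : ℕ) (s : State) : Prop :=
  (s.nat violator 0 = n ∧
    ∀ i : Fin n, i < k → dist (s.vec query 0) (c i) + r i ≤ s.real budget 0) ∨
  ∃ v : Fin n, s.nat violator 0 = v ∧ s.real budget 0 < dist (s.vec query 0) (c v) + r v ∧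
    s.real proj 0 = ⟪s.vec dir 0, c v⟫ ∧
    ∀ i : Fin n, i < k → s.real budget 0 < dist (s.vec query 0) (c i) + r i →
      s.real proj 0 ≤ ⟪s.vec dir 0, c i⟫

theorem Scanned.add_one_of_le {i : Fin n} (h : Scanned c r i s)
    (hi : dist (s.vec query 0) (c i) + r i ≤ s.real budget 0) : Scanned c r (i + 1) s := by
  simp only [Scanned, Order.lt_add_one_iff, Fin.val_fin_le, le_iff_lt_or_eq (a := (_ : Fin n))]
  rcases h with ⟨hv, hall⟩ | ⟨v, hv, hviolv, hprojv, hmin⟩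
  · refine .inl ⟨hv, ?_⟩
    rintro j (hj | rfl)
    exacts [hall j hj, hi]
  · refine .inr ⟨v, hv, hviolv, hprojv, ?_⟩
    rintro j (hj | rfl) hviolj
    exacts [hmin j hj hviolj, absurd hi hviolj.not_ge]

theorem scan_runs (h : Loaded c r s) : Runs scan s (n + 1) (Scanned c r n) := by
  rw [← mul_one (n + 1)]
  refine .straight_seq rfl fun hF₀ => .forRange (Scanned c r) (by simpa +decide using h.count)
    (.inl ⟨by simpa +decide using h.count, fun _ h => absurd h (Nat.not_lt_zero _)⟩) ?_
  rintro i s' hF hi hdisk hs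
  lift i to Fin n using hi
  have hL : Loaded c r s' := (h.frame hF₀).frame hF
  have hreach := eval_reachExp hL hdisk query
  have hproj := eval_projExp hL hdisk
  refine .cond (fun hviol => .cond (fun hold => .straight rfl ?_) fun hnew => .straight rfl ?_)
    fun hcov => .straight rfl ?_
  · simp only [BExp.eval, NExp.eval, RExp.eval, hreach, hproj, hL.count, not_lt] at hviol hold
    simp only [Prog.eff, Scanned, Order.lt_add_one_iff, Fin.val_fin_le,
      le_iff_lt_or_eq (a := (_ : Fin n))]
    rcases hs with ⟨hv, -⟩ | ⟨v, hv, hviolv, hprojv, hmin⟩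
    · omega
    · refine .inr ⟨v, hv, hviolv, hprojv, ?_⟩
      rintro j (hj | rfl) hviolj
      exacts [hmin j hj hviolj, hold.2]
  · simp only [BExp.eval, NExp.eval, RExp.eval, hreach, hproj, hL.count, not_and, not_not]
      at hviol hnew
    suffices hmin : ∀ j ≤ i, s'.real budget 0 < dist (s'.vec query 0) (c j) + r j →
        ⟪s'.vec dir 0, c i⟫ ≤ ⟪s'.vec dir 0, c j⟫ from
      .inr ⟨i, by simp +decide [hdisk], by simpa +decide using hviol,
        by simp +decide [projExp, hdisk, hL.center],
        by simpa +decide [projExp, hdisk, hL.center] using hmin⟩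
    intro j hj hviolj
    rcases hj.lt_or_eq with hj | rfl
    · rcases hs with ⟨-, hall⟩ | ⟨v, hv, -, -, hmin⟩
      · exact absurd (hall j hj) hviolj.not_ge
      · exact (hnew (hv.trans_lt v.2)).le.trans (hmin j hj hviolj)
    · exact le_rfl
  · simp only [BExp.eval, RExp.eval, NExp.eval, hreach, not_lt] at hcov
    exact hs.add_one_of_le hcov

/-! ### Covering a prefix -/

/-- Replace the current ellipse by one that covers its half closer to the violated disk. -/
def cutEllipse : Prog :=
  setR cosA (((vv query).sub (.cell center (nv violator))).inner (vv axisA)) ;;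
  setR cosB (((vv query).sub (.cell center (nv violator))).inner (vv axisB)) ;;
  setR gradNorm (.sqrt (.add (.mul (rv cosA) (rv cosA)) (.mul (rv cosB) (rv cosB)))) ;;
  setR cosA (.div (rv cosA) (rv gradNorm)) ;;
  setR cosB (.div (rv cosB) (rv gradNorm)) ;;
  setV pole (.add (.smul (rv cosA) (vv axisA)) (.smul (rv cosB) (vv axisB))) ;;
  setV axisB
    (.smul (.lit (7 / 6)) (.sub (.smul (rv cosA) (vv axisB)) (.smul (rv cosB) (vv axisA)))) ;;
  setV axisA (.smul (.lit (2 / 3)) (vv pole)) ;;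
  setV query (.sub (vv query) (.smul (.lit (1 / 3)) (vv pole)))

theorem cutEllipse_eff {q a b g : Plane} (hq : s.vec query 0 = q) (ha : s.vec axisA 0 = a)
    (hb : s.vec axisB 0 = b) (hg : q - s.vec center (s.nat violator 0) = g)
    (hab : cross a b ≠ 0) (hg₀ : g ≠ 0) (hs' : cutEllipse.eff s = s') :
    cross (s'.vec axisA 0) (s'.vec axisB 0) = 7 / 9 * cross a b ∧
      ∀ p ∈ ellipse q a b, ⟪g, p - q⟫ ≤ 0 →
        p ∈ ellipse (s'.vec query 0) (s'.vec axisA 0) (s'.vec axisB 0) := by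
  obtain ⟨ν, hν⟩ : ∃ ν, ν = √(⟪g, a⟫ * ⟪g, a⟫ + ⟪g, b⟫ * ⟪g, b⟫) := ⟨_, rfl⟩
  obtain ⟨α, hα⟩ : ∃ α, α = ⟪g, a⟫ / ν := ⟨_, rfl⟩
  obtain ⟨β, hβ⟩ : ∃ β, β = ⟪g, b⟫ / ν := ⟨_, rfl⟩
  have hcut : s'.vec query 0 = q - (1 / 3 : ℝ) • (α • a + β • b) ∧
      s'.vec axisA 0 = (2 / 3 : ℝ) • (α • a + β • b) ∧
      s'.vec axisB 0 = (7 / 6 : ℝ) • (α • b - β • a) := by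
    subst s'
    simp +decide [cutEllipse, hq, ha, hb, hg, ← hν, ← hα, ← hβ]
  have hpos : 0 < ⟪g, a⟫ * ⟪g, a⟫ + ⟪g, b⟫ * ⟪g, b⟫ := by
    refine (add_nonneg (mul_self_nonneg _) (mul_self_nonneg _)).lt_of_ne' fun h => hg₀ ?_
    rw [mul_self_add_mul_self_eq_zero] at h
    exact eq_zero_of_inner_eq_zero hab h.1 h.2
  have hν₀ : 0 < ν := hν ▸ Real.sqrt_pos.2 hpos
  have hαβ : α ^ 2 + β ^ 2 = 1 := by
    rw [hα, hβ, div_pow, div_pow, ← add_div, div_eq_one_iff_eq (by positivity), hν,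
      Real.sq_sqrt hpos.le, sq, sq]
  rw [hcut.1, hcut.2.1, hcut.2.2]
  exact ⟨cross_cut a b hαβ, fun p hp hgp => mem_ellipse_cut hp hν₀ hαβ
    (by rw [hα, mul_div_cancel₀ _ hν₀.ne']) (by rw [hβ, mul_div_cancel₀ _ hν₀.ne']) hgp⟩

section EllipseInv

variable {ρ : ℝ} {k : ℕ}

/-- The invariant of the ellipsoid method after `k` cuts. The disk around `Reg.bestCenter` contains
the disks whose projection is less than `Reg.bestProj`. If a set `S` of disks is a prefix that is
covered with slack `ρ` by the disk around `x`, then either the search has already succeeded for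
`S`, or the ellipse still contains all points that are so close to `x` that their disks cover `S`
as well. -/
structure EllipseInv (c : Fin n → Plane) (r : Fin n → ℝ) (ρ : ℝ) (k : ℕ) (s : State) : Prop where
  best : ∀ i, s.real budget 0 < dist (s.vec bestCenter 0) (c i) + r i →
    s.real bestProj 0 ≤ ⟪s.vec dir 0, c i⟫
  progress : ∀ S x, IsPrefix c (s.vec dir 0) S → S.Nonempty →
    (∀ i ∈ S, dist x (c i) + r i + ρ ≤ s.real budget 0) →
    (s.vec bestCenter 0 = s.vec query 0 ∧
        ∀ i, dist (s.vec query 0) (c i) + r i ≤ s.real budget 0) ∨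
      (∃ v ∉ S, ⟪s.vec dir 0, c v⟫ ≤ s.real bestProj 0) ∨
      cross (s.vec axisA 0) (s.vec axisB 0) = s.real budget 0 ^ 2 * (7 / 9) ^ k ∧
        closedBall x ρ ⊆ ellipse (s.vec query 0) (s.vec axisA 0) (s.vec axisB 0)

theorem EllipseInv.setNat (h : EllipseInv c r ρ k s) (a i v : ℕ) :
    EllipseInv c r ρ k (s.setNat a i v) :=
  ⟨h.best, h.progress⟩

theorem EllipseInv.scan (h : EllipseInv c r ρ k s) (hF : Frame scan s s') :
    EllipseInv c r ρ k s' := by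
  constructor <;>
    simp only [hF.vec dir 0, hF.vec bestCenter 0, hF.vec query 0, hF.vec axisA 0, hF.vec axisB 0,
      hF.real budget 0, hF.real bestProj 0]
  exacts [h.best, h.progress]

/-- Remember the current center if it covers more disks than the best one so far. -/
def keepBest : Prog :=
  .cond (.realLt (rv bestProj) (rv proj))
    (setV bestCenter (vv query) ;; setR bestProj (rv proj)) .skip

theorem EllipseInv.keepBest (h : EllipseInv c r ρ k s)
    (hmin : ∀ i, s.real budget 0 < dist (s.vec query 0) (c i) + r i →
      s.real proj 0 ≤ ⟪s.vec dir 0, c i⟫) :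
    EllipseInv c r ρ k (TwoCenter.keepBest.eff s) := by
  by_cases hlt : s.real bestProj 0 < s.real proj 0
  · have hF : Frame TwoCenter.keepBest s (TwoCenter.keepBest.eff s) := .eff rfl s
    have hcenter : (TwoCenter.keepBest.eff s).vec bestCenter 0 = s.vec query 0 := by
      simp +decide [TwoCenter.keepBest, hlt]
    have hproj : (TwoCenter.keepBest.eff s).real bestProj 0 = s.real proj 0 := by
      simp +decide [TwoCenter.keepBest, hlt]
    constructor <;>
      simp only [hF.vec dir 0, hF.vec query 0, hF.vec axisA 0, hF.vec axisB 0, hF.real budget 0,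
        hcenter, hproj]
    · exact hmin
    · intro S x hS hne hfit
      rcases h.progress S x hS hne hfit with ⟨-, hcov⟩ | ⟨v, hvS, hv⟩ | hell
      · exact .inl ⟨trivial, hcov⟩
      · exact .inr (.inl ⟨v, hvS, hv.trans hlt.le⟩)
      · exact .inr (.inr hell)
  · simpa +decide [TwoCenter.keepBest, hlt] using h

theorem proj_le_keepBest (s : State) :
    s.real proj 0 ≤ (keepBest.eff s).real bestProj 0 := by
  unfold keepBest
  by_cases hlt : s.real bestProj 0 < s.real proj 0
  · simp +decide [hlt]
  · simpa +decide [hlt] using not_lt.1 hlt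

theorem EllipseInv.cutEllipse (h : EllipseInv c r ρ k s) (hL : Loaded c r s)
    (hR : 0 < s.real budget 0) (hρ : 0 ≤ ρ) {v : Fin n} (hv : s.nat violator 0 = v)
    (hviol : s.real budget 0 < dist (s.vec query 0) (c v) + r v)
    (hproj : ⟪s.vec dir 0, c v⟫ ≤ s.real bestProj 0) :
    EllipseInv c r ρ (k + 1) (TwoCenter.cutEllipse.eff s) := by
  have hF : Frame TwoCenter.cutEllipse s (TwoCenter.cutEllipse.eff s) :=
    .eff rfl s
  constructor <;>
    simp only [hF.vec dir 0, hF.vec bestCenter 0, hF.real budget 0, hF.real bestProj 0]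
  · exact h.best
  intro S x hS hne hfit
  rcases h.progress S x hS hne hfit with ⟨-, hcov⟩ | hfound | ⟨hcross, hball⟩
  · exact absurd (hcov v) hviol.not_ge
  · exact .inr (.inl hfound)
  by_cases hvS : v ∈ S
  · have hcloser : ∀ p ∈ closedBall x ρ, dist p (c v) ≤ dist (s.vec query 0) (c v) := fun p hp => by
      linarith [dist_triangle p x (c v), mem_closedBall.1 hp, hfit v hvS]
    have hne : s.vec query 0 - c v ≠ 0 := fun h₀ => by
      rw [sub_eq_zero.1 h₀, dist_self] at hviol
      linarith [hfit v hvS, dist_nonneg (x := x) (y := c v)]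
    obtain ⟨hcross', hcut⟩ := cutEllipse_eff (s := s) rfl rfl rfl (by rw [hv, hL.center])
      (by rw [hcross]; positivity) hne rfl
    refine .inr (.inr ⟨by rw [hcross', hcross]; ring, fun p hp => hcut p (hball hp) ?_⟩)
    exact inner_sub_nonpos_of_dist_le (hcloser p hp)
  · exact .inr (.inl ⟨v, hvS, hproj⟩)

/-- An iteration of the ellipsoid method. -/
def ellipseStep : Prog :=
  scan ;;
  .cond (.natLt (nv violator) (nv count)) (keepBest ;; cutEllipse) (setV bestCenter (vv query))

theorem ellipseStep_runs (hL : Loaded c r s) (hR : 0 < s.real budget 0) (hρ : 0 ≤ ρ)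
    (h : EllipseInv c r ρ k s) :
    Runs ellipseStep s (n + 1) (EllipseInv c r ρ (k + 1)) := by
  refine (scan_runs hL).seq fun s₁ hF₁ hs₁ => ?_
  have hL₁ := hL.frame hF₁
  have h₁ := h.scan hF₁
  rw [← hF₁.real budget 0] at hR
  refine .cond (fun hlt => ?_) fun hge => .straight rfl ?_
  · simp only [BExp.eval, NExp.eval, hL₁.count] at hlt
    obtain ⟨hv, -⟩ | ⟨v, hv, hviol, hproj, hmin⟩ := hs₁
    · omega
    refine .straight_seq rfl fun hF₂ => .straight rfl ?_
    refine (h₁.keepBest fun i => hmin i i.2).cutEllipse (v := v) (hL₁.frame hF₂) ?_ hρ ?_ ?_ ?_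
    · rwa [hF₂.real budget 0]
    · rwa [hF₂.nat violator 0]
    · rwa [hF₂.real budget 0, hF₂.vec query 0]
    · rw [hF₂.vec dir 0, ← hproj]
      exact proj_le_keepBest s₁
  · simp only [BExp.eval, NExp.eval, hL₁.count] at hge
    obtain ⟨-, hcov⟩ | ⟨v, hv, -⟩ := hs₁
    · have hcov' := fun i => hcov i i.2
      constructor
      · simpa +decide using fun i hi => absurd (hcov' i) (not_le.2 hi)
      · simp +decide [hcov']
    · omega

theorem EllipseInv.dist_add_le (h : EllipseInv c r ρ k s) (hρ : 0 ≤ ρ)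
    (hk : s.real budget 0 ^ 2 * (7 / 9) ^ k < ρ ^ 2) {S : Set (Fin n)} {x : Plane}
    (hS : IsPrefix c (s.vec dir 0) S) (hfit : ∀ i ∈ S, dist x (c i) + r i + ρ ≤ s.real budget 0)
    {i : Fin n} (hi : i ∈ S) : dist (s.vec bestCenter 0) (c i) + r i ≤ s.real budget 0 := by
  rcases h.progress S x hS ⟨i, hi⟩ hfit with ⟨hbest, hcov⟩ | ⟨v, hvS, hv⟩ | ⟨hcross, hball⟩
  · exact hbest ▸ hcov i
  · by_contra! hviol
    linarith [h.best i hviol, hS i hi v hvS]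
  · have hsq := sq_le_abs_cross_of_closedBall_subset hρ hball
    rw [hcross, abs_of_nonneg (by positivity)] at hsq
    exact absurd hsq hk.not_ge

/-- Start the ellipsoid method with a disk around the center of the violated disk. -/
def startEllipse : Prog :=
  setV query (.cell center (nv violator)) ;;
  setV bestCenter (.cell center (nv violator)) ;;
  setR bestProj (rv proj) ;;
  setV axisA ⟨rv target, .lit 0⟩ ;;
  setV axisB ⟨.lit 0, rv target⟩ ;;
  setR budget (rv target)

theorem ellipseInv_startEllipse (hL : Loaded c r s) (hr : ∀ i, 0 ≤ r i)
    (hR : 0 < s.real target 0) {v : Fin n} (hv : s.nat violator 0 = v)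
    (hproj : s.real proj 0 = ⟪s.vec dir 0, c v⟫)
    (hmin : ∀ i, s.real proj 0 ≤ ⟪s.vec dir 0, c i⟫) :
    EllipseInv c r ρ 0 (startEllipse.eff s) := by
  have hF : Frame startEllipse s (startEllipse.eff s) := .eff rfl s
  have hquery : (startEllipse.eff s).vec query 0 = c v := by
    simp +decide [startEllipse, hv, hL.center]
  obtain ⟨hbest, hA, hB, hbudget⟩ :
      (startEllipse.eff s).real bestProj 0 = s.real proj 0 ∧
      (startEllipse.eff s).vec axisA 0 = !₂[s.real target 0, 0] ∧
      (startEllipse.eff s).vec axisB 0 = !₂[0, s.real target 0] ∧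
      (startEllipse.eff s).real budget 0 = s.real target 0 := by
    simp +decide [startEllipse, VExp.eval]
  constructor <;> simp only [hF.vec dir 0, hquery, hbest, hA, hB, hbudget]
  · exact fun i _ => hmin i
  intro S x hS ⟨i, hi⟩ hfit
  have hvS : v ∈ S := by
    by_contra hvS
    exact (hS i hi v hvS).not_ge (hproj ▸ hmin i)
  refine .inr (.inr ⟨by simp [cross, sq], subset_trans (fun p hp => ?_)
    (closedBall_subset_ellipse _ hR)⟩)
  rw [mem_closedBall]
  linarith [mem_closedBall.1 hp, dist_triangle p x (c v), hfit v hvS, hr v]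

/-- Search for a disk of radius `Reg.target` that contains all disks of a prefix in the direction
`Reg.dir` which is as long as possible. -/
def ellipseRun : Prog :=
  setR budget (.lit (-1)) ;; scan ;; startEllipse ;; forRange iteration iterations ellipseStep

theorem ellipseRun_runs [NeZero n] (hL : Loaded c r s) (hr : ∀ i, 0 ≤ r i) {R θ : ℝ} {T : ℕ}
    (hR : s.real target 0 = R) (hR₀ : 0 < R) (hθ : 0 ≤ θ) (hT : s.nat iterations 0 = T)
    (hTθ : (7 / 9) ^ T < θ ^ 2) :
    Runs ellipseRun s ((T + 1) * (n + 1)) fun s' =>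
      ∀ S x, IsPrefix c (s.vec dir 0) S → (∀ i ∈ S, dist x (c i) + r i ≤ (1 - θ) * R) →
        ∀ i ∈ S, dist (s'.vec bestCenter 0) (c i) + r i ≤ R := by
  refine .straight_seq rfl fun hF₁ => ?_
  have hL₁ := hL.frame hF₁
  refine .seq ((scan_runs hL₁).mono (Nat.le_mul_of_pos_left _ (by omega)) fun _ _ h => h)
    fun s₂ hF₂ hs₂ => ?_
  have hL₂ := hL₁.frame hF₂
  have hR₂ : s₂.real target 0 = R := by rw [hF₂.real target 0, hF₁.real target 0, hR]
  have hviol : ∀ i, s₂.real budget 0 < dist (s₂.vec query 0) (c i) + r i := fun i => by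
    have hbudget : s₂.real budget 0 = -1 := by rw [hF₂.real budget 0]; simp
    linarith [hr i, dist_nonneg (x := s₂.vec query 0) (y := c i)]
  obtain ⟨v, hv, -, hproj, hmin⟩ := hs₂.resolve_left fun h =>
    (hviol 0).not_ge (h.2 0 (0 : Fin n).2)
  refine .straight_seq rfl fun hF₃ => ?_
  have hI : EllipseInv c r (θ * R) 0 (startEllipse.eff s₂) :=
    ellipseInv_startEllipse hL₂ hr (hR₂ ▸ hR₀) hv hproj fun i => hmin i i.2 (hviol i)
  have hbudget₃ : (startEllipse.eff s₂).real budget 0 = R := by simp +decide [startEllipse, hR₂]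
  have hdir₃ : (startEllipse.eff s₂).vec dir 0 = s.vec dir 0 := by
    rw [hF₃.vec dir 0, hF₂.vec dir 0, hF₁.vec dir 0]
  refine (Runs.forRange (EllipseInv c r (θ * R)) (n := T) ?_ ?_ fun k s' hF _ _ h => ?_).imp
    fun s' hF h => ?_
  · rw [hF₃.nat iterations 0, hF₂.nat iterations 0, hF₁.nat iterations 0, hT]
  · exact hI.setNat ..
  · exact (ellipseStep_runs ((hL₂.frame hF₃).frame hF) (by rwa [hF.real budget 0, hbudget₃])
      (by positivity) h).imp fun _ _ h => h.setNat ..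
  · have hbudget : s'.real budget 0 = R := by rw [hF.real budget 0, hbudget₃]
    intro S x hS hfit i hi
    rw [← hbudget]
    refine h.dist_add_le (by positivity) ?_ (x := x) ?_ (fun j hj => ?_) hi
    · rw [hbudget, mul_pow, mul_comm]
      gcongr
    · rwa [hF.vec dir 0, hdir₃]
    · linarith [hfit j hj]

end EllipseInv

/-! ### Improving a cover -/

theorem forall_val_lt_add_one {P : Fin n → Prop} {i : Fin n} (h : ∀ j : Fin n, (j : ℕ) < i → P j)
    (hi : P i) (j : Fin n) (hj : (j : ℕ) < i + 1) : P j :=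
  (Nat.lt_succ_iff_lt_or_eq.1 hj).elim (h j) fun hji => Fin.ext hji ▸ hi

/-- Test whether the disks of radius `Reg.target` around `Reg.firstCenter` and `Reg.bestCenter` form
a cover. -/
def check : Prog :=
  setN uncovered (.lit 0) ;;
  forRange disk count
    (.cond (.and (.realLt (rv target) (reachExp firstCenter))
        (.realLt (rv target) (reachExp bestCenter)))
      (setN uncovered (.lit 1)) .skip)

theorem check_runs (h : Loaded c r s) : Runs check s (n + 1) fun s' =>
    s'.nat uncovered 0 = 0 ↔
      Covers c r (s'.vec firstCenter 0) (s'.vec bestCenter 0) (s'.real target 0) := by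
  rw [← mul_one (n + 1)]
  refine .straight_seq rfl fun hF₀ => (Runs.forRange (n := n) (fun k s' =>
    s'.nat uncovered 0 = 0 ↔ ∀ i : Fin n, i < k →
      dist (s'.vec firstCenter 0) (c i) + r i ≤ s'.real target 0 ∨
      dist (s'.vec bestCenter 0) (c i) + r i ≤ s'.real target 0) ?_ ?_ ?_).imp
    fun s' _ hs' => hs'.trans ⟨fun h i => h i i.2, fun h i _ => h i⟩
  · simpa +decide using h.count
  · simp +decide
  rintro i s' hF hi hdisk hs
  lift i to Fin n using hi
  have hL : Loaded c r s' := (h.frame hF₀).frame hF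
  refine .cond (fun hout => .straight rfl ?_) fun hin => .straight rfl ?_
  · simp only [BExp.eval, RExp.eval, NExp.eval, eval_reachExp hL hdisk] at hout
    suffices ∃ j ≤ i, ¬ (dist (s'.vec firstCenter 0) (c j) + r j ≤ s'.real target 0 ∨
        dist (s'.vec bestCenter 0) (c j) + r j ≤ s'.real target 0) by
      simpa +decide [Order.lt_add_one_iff] using this
    exact ⟨i, le_rfl, by simpa only [not_or, not_le] using hout⟩
  · simp only [BExp.eval, RExp.eval, NExp.eval, eval_reachExp hL hdisk, not_and_or, not_lt] at hin
    exact hs.trans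
      ⟨(forall_val_lt_add_one · hin), fun h j hj => h j (hj.trans (Nat.lt_succ_self _))⟩

/-- Search for a cover of radius `Reg.target` that is split in the direction `Reg.dir`. -/
def findCover : Prog :=
  ellipseRun ;;
  (setV firstCenter (vv bestCenter) ;; setV dir (.smul (.lit (-1)) (vv dir))) ;;
  ellipseRun ;;
  check

theorem findCover_runs [NeZero n] (hL : Loaded c r s) (hr : ∀ i, 0 ≤ r i) {R θ : ℝ} {T : ℕ}
    (hR : s.real target 0 = R) (hR₀ : 0 < R) (hθ : 0 ≤ θ) (hT : s.nat iterations 0 = T)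
    (hTθ : (7 / 9) ^ T < θ ^ 2) :
    Runs findCover s ((T + 1) * (n + 1)) fun s' =>
      (s'.nat uncovered 0 = 0 ↔ Covers c r (s'.vec firstCenter 0) (s'.vec bestCenter 0) R) ∧
      (HasSplit c r (s.vec dir 0) ((1 - θ) * R) →
        Covers c r (s'.vec firstCenter 0) (s'.vec bestCenter 0) R) := by
  refine (ellipseRun_runs hL hr hR hR₀ hθ hT hTθ).seq fun s₁ hF₁ h₁ =>
    .straight_seq rfl fun hF₂ => ?_
  generalize hs₂ : Prog.eff _ s₁ = s₂ at hF₂ ⊢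
  obtain ⟨hfirst, hdir⟩ : s₂.vec firstCenter 0 = s₁.vec bestCenter 0 ∧
      s₂.vec dir 0 = -s₁.vec dir 0 := by
    subst s₂
    simp +decide
  have hL₂ := (hL.frame hF₁).frame hF₂
  refine (ellipseRun_runs hL₂ hr (by rw [hF₂.real target 0, hF₁.real target 0, hR]) hR₀ hθ
    (by rw [hF₂.nat iterations 0, hF₁.nat iterations 0, hT]) hTθ).seq fun s₃ hF₃ h₃ => ?_
  refine (check_runs (hL₂.frame hF₃)).mono (Nat.le_mul_of_pos_left _ (by omega))
    fun s₄ hF₄ h₄ => ?_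
  rw [hF₄.real target 0, hF₃.real target 0, hF₂.real target 0, hF₁.real target 0, hR] at h₄
  refine ⟨h₄, fun ⟨S, p₁, p₂, hS, hp₁, hp₂⟩ i => ?_⟩
  rw [hF₄.vec firstCenter 0, hF₄.vec bestCenter 0, hF₃.vec firstCenter 0, hfirst]
  rw [hdir, hF₁.vec dir 0] at h₃
  by_cases hi : i ∈ S
  · exact .inl (h₁ S p₁ hS hp₁ i hi)
  · exact .inr (h₃ Sᶜ p₂ hS.compl hp₂ i hi)

/-- Two disks of radius `Reg.best` around `Reg.cover₁` and `Reg.cover₂` form a cover. -/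
structure HasCover (c : Fin n → Plane) (r : Fin n → ℝ) (s : State) : Prop where
  pos : 0 < s.real best 0
  covers : Covers c r (s.vec cover₁ 0) (s.vec cover₂ 0) (s.real best 0)

theorem HasCover.frame {p : Prog} (h : HasCover c r s) (hF : Frame p s s')
    (h₁ : best ∉ p.realWrites := by decide) (h₂ : cover₁ ∉ p.realWrites := by decide)
    (h₃ : cover₁ + 1 ∉ p.realWrites := by decide) (h₄ : cover₂ ∉ p.realWrites := by decide)
    (h₅ : cover₂ + 1 ∉ p.realWrites := by decide) : HasCover c r s' where
  pos := by rw [hF.real _ _ h₁]; exact h.pos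
  covers := by rw [hF.real _ _ h₁, hF.vec _ _ h₂ h₃, hF.vec _ _ h₄ h₅]; exact h.covers

/-- Replace the best cover by the new one. -/
def acceptCover : Prog :=
  setV cover₁ (vv firstCenter) ;; setV cover₂ (vv bestCenter) ;; setR best (rv target)

/-- Try to improve the best radius by the factor `Reg.factor` in the current direction. Go on to
the next direction if this fails. -/
def tryDir : Prog :=
  (setV dir (.cell dirs (nv dirIndex)) ;; setR target (.div (rv best) (.add (.lit 1) (rv factor))))
    ;; findCover ;; .cond (.natLt (.lit 0) (nv uncovered)) (incr dirIndex) acceptCover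

theorem tryDir_runs [NeZero n] (hL : Loaded c r s) (hr : ∀ i, 0 ≤ r i) {θ η : ℝ} {T k : ℕ}
    (hθ : 0 ≤ θ) (hT : s.nat iterations 0 = T) (hTθ : (7 / 9) ^ T < θ ^ 2) (hη : 0 < η)
    (hfactor : s.real factor 0 = η) (hk : s.nat dirIndex 0 = k) (hbest : HasCover c r s) :
    Runs tryDir s ((T + 1) * (n + 1)) fun s' => HasCover c r s' ∧
      ((s'.nat dirIndex 0 = k + 1 ∧ s'.real best 0 = s.real best 0 ∧
          ¬ HasSplit c r (s.vec dirs k) ((1 - θ) * (s.real best 0 / (1 + η)))) ∨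
        s'.nat dirIndex 0 = k ∧ s'.real best 0 = s.real best 0 / (1 + η)) := by
  have hR₀ : 0 < s.real best 0 / (1 + η) := div_pos hbest.pos (by linarith)
  refine .straight_seq rfl fun hF₁ => ?_
  generalize hs₁ : Prog.eff _ s = s₁ at hF₁ ⊢
  obtain ⟨hdir, htarget⟩ : s₁.vec dir 0 = s.vec dirs k ∧
      s₁.real target 0 = s.real best 0 / (1 + η) := by
    subst s₁
    simp +decide [hfactor, hk]
  have hL₁ := hL.frame hF₁
  refine (findCover_runs hL₁ hr htarget hR₀ hθ (by rw [hF₁.nat iterations 0, hT]) hTθ).seq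
    fun s₂ hF₂ ⟨hcov, hsplit⟩ => ?_
  rw [← hdir]
  have hk₂ : s₂.nat dirIndex 0 = k := by rw [hF₂.nat dirIndex 0, hF₁.nat dirIndex 0, hk]
  have htarget₂ : s₂.real target 0 = s.real best 0 / (1 + η) := by
    rw [hF₂.real target 0, htarget]
  refine .cond (fun hun => .straight rfl ?_) fun hun => .straight rfl ?_
  · refine ⟨((hbest.frame hF₁).frame hF₂).frame (.eff rfl s₂), .inl ⟨by simp [hk₂], ?_, ?_⟩⟩
    · simp [hF₂.real best 0, hF₁.real best 0]
    · exact fun h => hun.ne' (hcov.2 (hsplit h))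
  · have hcov₂ := hcov.1 (Nat.eq_zero_of_not_pos hun)
    exact ⟨⟨by simpa +decide [acceptCover, htarget₂] using hR₀,
      by simpa +decide [acceptCover, htarget₂] using hcov₂⟩,
      .inr ⟨by simp +decide [acceptCover, hk₂], by simp +decide [acceptCover, htarget₂]⟩⟩

/-- The radius `b` is at most `ρ` times the radius of any cover. -/
def IsApproxRadius (c : Fin n → Plane) (r : Fin n → ℝ) (ρ b : ℝ) : Prop :=
  ∀ p₁ p₂ R, Covers c r p₁ p₂ R → b ≤ ρ * R

theorem IsApproxRadius.le_of_mul_pow_eq {b b' η : ℝ} {k M : ℕ}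
    (h : IsApproxRadius c r (1 + M * η) b) (hη : 0 < η) {p₁ p₂ : Plane} (hcov : Covers c r p₁ p₂ b')
    (hb' : 0 < b') (hk : b' * (1 + η) ^ k = b) : k ≤ M := by
  have hpow : (1 + η) ^ k ≤ 1 + M * η :=
    le_of_mul_le_mul_right (by rw [mul_comm, hk]; exact h _ _ _ hcov) hb'
  have hbernoulli := one_add_mul_le_pow (show (-2 : ℝ) ≤ η by linarith) k
  have hkM : (k : ℝ) * η ≤ M * η := by linarith
  exact_mod_cast le_of_mul_le_mul_right hkM hη

/-- Improve the best cover until no direction admits an improvement by the factor `Reg.factor`. -/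
def pass : Prog := setN dirIndex (.lit 0) ;; .loop (.natLt (nv dirIndex) (nv dirCount)) tryDir

/-- The invariant of `pass` with `m` steps left: the `k` improvements and the `i` failures so far
account for the other steps. -/
def PassInv (c : Fin n → Plane) (r : Fin n → ℝ) (d : ℕ → Plane) (b θ η : ℝ) (N M m : ℕ)
    (s : State) : Prop :=
  HasCover c r s ∧ ∃ i k, s.nat dirIndex 0 = i ∧ i ≤ N ∧ k ≤ M ∧ m + i + k = N + M ∧
    s.real best 0 * (1 + η) ^ k = b ∧
    ∀ j < i, ¬ HasSplit c r (d j) ((1 - θ) * (s.real best 0 / (1 + η)))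

theorem PassInv.tryDir_runs [NeZero n] {d : ℕ → Plane} {b θ η : ℝ} {N M m T : ℕ}
    (h : PassInv c r d b θ η N M m s) (hL : Loaded c r s) (hr : ∀ i, 0 ≤ r i) (hθ : 0 ≤ θ)
    (hθ₁ : θ ≤ 1) (hT : s.nat iterations 0 = T) (hTθ : (7 / 9) ^ T < θ ^ 2) (hη : 0 < η)
    (hfactor : s.real factor 0 = η) (hd : s.vec dirs = d) (hlt : s.nat dirIndex 0 < N)
    (hM : IsApproxRadius c r (1 + M * η) b) :
    ∃ m', m = m' + 1 ∧ Runs tryDir s ((T + 1) * (n + 1)) (PassInv c r d b θ η N M m') := by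
  obtain ⟨hbest, i, k, hi, hiN, hkM, hm, hpow, hfail⟩ := h
  obtain ⟨m, rfl⟩ : ∃ m', m = m' + 1 := ⟨m - 1, by omega⟩
  refine ⟨m, rfl, (TwoCenter.tryDir_runs hL hr hθ hT hTθ hη hfactor hi hbest).imp ?_⟩
  rintro s' - ⟨hbest', ⟨hi', hb', hsplit⟩ | ⟨hi', hb'⟩⟩
  · refine ⟨hbest', i + 1, k, hi', by omega, hkM, by omega, by rw [hb', hpow], fun j hj => ?_⟩
    rw [hb']
    rcases Nat.lt_succ_iff_lt_or_eq.1 hj with hj | rfl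
    · exact hfail j hj
    · rwa [← hd]
  · have hpow' : s'.real best 0 * (1 + η) ^ (k + 1) = b := by
      rw [hb', ← hpow, pow_succ]
      field_simp
    have hkM' := hM.le_of_mul_pow_eq hη hbest'.covers hbest'.pos hpow'
    refine ⟨hbest', i, k + 1, hi', hiN, hkM', by omega, hpow', fun j hj hsplit => ?_⟩
    refine hfail j hj (hsplit.mono ?_)
    have hle : s'.real best 0 ≤ s.real best 0 :=
      hb' ▸ div_le_self hbest.pos.le (by linarith)
    gcongr

theorem pass_runs [NeZero n] {θ η : ℝ} {N M T : ℕ} (hL : Loaded c r s) (hr : ∀ i, 0 ≤ r i)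
    (hθ : 0 ≤ θ) (hθ₁ : θ ≤ 1) (hT : s.nat iterations 0 = T) (hTθ : (7 / 9) ^ T < θ ^ 2)
    (hη : 0 < η) (hfactor : s.real factor 0 = η) (hN : s.nat dirCount 0 = N)
    (hbest : HasCover c r s) (hM : IsApproxRadius c r (1 + M * η) (s.real best 0)) :
    Runs pass s ((N + M + 1) * ((T + 1) * (n + 1))) fun s' => HasCover c r s' ∧
      ∀ k < N, ¬ HasSplit c r (s.vec dirs k) ((1 - θ) * (s'.real best 0 / (1 + η))) := by
  refine .straight_seq rfl fun hF₁ => ?_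
  generalize hs₁ : Prog.eff _ s = s₁ at hF₁ ⊢
  have hi₁ : s₁.nat dirIndex 0 = 0 := by subst s₁; simp
  refine .loop (PassInv c r (s.vec dirs) (s.real best 0) θ η N M) (N + M) ?_ ?_ ?_
  · exact ⟨hbest.frame hF₁, 0, 0, hi₁, by omega, by omega, by omega,
      by rw [hF₁.real best 0, pow_zero, mul_one], by simp⟩
  · intro m s₂ hF₂ h hlt
    refine h.tryDir_runs ((hL.frame hF₁).frame hF₂) hr hθ hθ₁ ?_ hTθ hη ?_ ?_ ?_ hM
    · rw [hF₂.nat iterations 0, hF₁.nat iterations 0, hT]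
    · rw [hF₂.real factor 0, hF₁.real factor 0, hfactor]
    · exact funext fun k => by rw [hF₂.vec dirs k, hF₁.vec dirs k]
    · simpa only [BExp.eval, NExp.eval, hF₂.nat dirCount 0, hF₁.nat dirCount 0, hN] using hlt
  · rintro m s₂ hF₂ ⟨hbest₂, i, k, hi, hiN, -, -, -, hfail⟩ hge
    simp only [BExp.eval, NExp.eval, hF₂.nat dirCount 0, hF₁.nat dirCount 0, hN, hi] at hge
    exact ⟨hbest₂, fun j hj => hfail j (by omega)⟩

/-- Perform passes with smaller and smaller factors. -/
def passes : Prog :=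
  .loop (.not (.realLt (rv factor) (rv precision)))
    (pass ;; setR factor (.div (rv factor) (.lit 2)))

theorem isApproxRadius_of_not_hasSplit [NeZero n] {θ η b : ℝ} {N : ℕ} {d : ℕ → Plane}
    (hr : ∀ i, 0 ≤ r i) (hθ : 0 < θ) (hθη : θ ≤ η) (hθ₁ : θ ≤ 1 / 8)
    (hd : ∀ p₁ p₂ R, Covers c r p₁ p₂ R → ∃ k < N, HasSplit c r (d k) ((1 + θ) * R))
    (hfail : ∀ k < N, ¬ HasSplit c r (d k) ((1 - θ) * (b / (1 + η)))) :
    IsApproxRadius c r (1 + 4 * η) b := by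
  intro p₁ p₂ R hcov
  obtain ⟨k, hk, hsplit⟩ := hd p₁ p₂ R hcov
  have hlt : (1 - θ) * (b / (1 + η)) < (1 + θ) * R := by
    by_contra! hle
    exact hfail k hk (hsplit.mono hle)
  rw [← mul_div_assoc, div_lt_iff₀ (by linarith)] at hlt
  have hR : 0 ≤ R := hcov.nonneg hr
  have hfactor : (1 + θ) * (1 + η) ≤ (1 - θ) * (1 + 4 * η) := by nlinarith
  refine le_of_mul_le_mul_left (hlt.le.trans ?_) (show 0 < 1 - θ by linarith)
  calc (1 + θ) * R * (1 + η) = (1 + θ) * (1 + η) * R := by ring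
    _ ≤ (1 - θ) * (1 + 4 * η) * R := by gcongr
    _ = (1 - θ) * ((1 + 4 * η) * R) := by ring

theorem IsApproxRadius.mono [NeZero n] {ρ ρ' b : ℝ} (h : IsApproxRadius c r ρ b)
    (hr : ∀ i, 0 ≤ r i) (hρ : ρ ≤ ρ') : IsApproxRadius c r ρ' b :=
  fun p₁ p₂ R hcov => (h p₁ p₂ R hcov).trans (mul_le_mul_of_nonneg_right hρ (hcov.nonneg hr))

theorem passes_runs [NeZero n] {θ : ℝ} {N M T L : ℕ} (hL : Loaded c r s) (hr : ∀ i, 0 ≤ r i)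
    (hθ : 0 < θ) (hθ₁ : θ ≤ 1 / 8) (hT : s.nat iterations 0 = T) (hTθ : (7 / 9) ^ T < θ ^ 2)
    (hN : s.nat dirCount 0 = N) (hprecision : s.real precision 0 = θ)
    (hfactor : θ ≤ s.real factor 0) (hlevels : s.real factor 0 < θ * 2 ^ L) (hM₈ : 8 ≤ M)
    (hbest : HasCover c r s) (hM : IsApproxRadius c r (1 + M * s.real factor 0) (s.real best 0))
    (hd : ∀ p₁ p₂ R, Covers c r p₁ p₂ R → ∃ k < N, HasSplit c r (s.vec dirs k) ((1 + θ) * R)) :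
    Runs passes s ((L + 1) * ((N + M + 1) * ((T + 1) * (n + 1)))) fun s' =>
      HasCover c r s' ∧ IsApproxRadius c r (1 + 8 * θ) (s'.real best 0) := by
  refine .loop (fun m s' => 0 < s'.real factor 0 ∧ s'.real factor 0 < θ * 2 ^ m ∧ HasCover c r s' ∧
    IsApproxRadius c r (1 + M * s'.real factor 0) (s'.real best 0) ∧
    (θ ≤ s'.real factor 0 ∨ IsApproxRadius c r (1 + 8 * s'.real factor 0) (s'.real best 0))) L
    ⟨by linarith, hlevels, hbest, hM, .inl hfactor⟩ ?_ ?_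
  · rintro m s₁ hF₁ ⟨hη, hm, hbest₁, hM₁, -⟩ hge
    simp only [BExp.eval, RExp.eval, NExp.eval, hF₁.real precision 0, hprecision, not_lt] at hge
    obtain ⟨m, rfl⟩ : ∃ m', m = m' + 1 := Nat.exists_eq_succ_of_ne_zero fun h₀ => by
      rw [h₀, pow_zero, mul_one] at hm
      exact hm.not_ge hge
    refine ⟨m, rfl, (pass_runs (hL.frame hF₁) hr hθ.le (by linarith)
      (by rw [hF₁.nat iterations 0, hT]) hTθ hη rfl (by rw [hF₁.nat dirCount 0, hN]) hbest₁
      hM₁).seq fun s₂ hF₂ ⟨hbest₂, hfail⟩ => .straight rfl ?_⟩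
    have happrox := isApproxRadius_of_not_hasSplit hr hθ hge hθ₁ hd
      fun k hk => hF₁.vec dirs k ▸ hfail k hk
    rw [← hF₂.real factor 0] at happrox hm hη
    generalize hs₃ : Prog.eff _ s₂ = s₃
    have hF₃ : Frame (setR factor (.div (rv factor) (.lit 2))) s₂ s₃ := hs₃ ▸ Frame.eff rfl s₂
    have hhalf : s₂.real factor 0 = 2 * s₃.real factor 0 := by
      subst s₃
      simp [mul_div_cancel₀]
    rw [← hF₃.real best 0, hhalf, ← mul_assoc, show (4 : ℝ) * 2 = 8 by norm_num] at happrox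
    rw [hhalf] at hm hη
    refine ⟨by linarith, by rw [pow_succ] at hm; linarith, hbest₂.frame hF₃, ?_, .inr happrox⟩
    have hM₈' : (8 : ℝ) ≤ M := by exact_mod_cast hM₈
    exact happrox.mono hr (by nlinarith)
  · rintro m s₁ hF₁ ⟨-, -, hbest₁, -, hlast⟩ hlt
    simp only [BExp.eval, RExp.eval, NExp.eval, hF₁.real precision 0, hprecision, not_not] at hlt
    exact ⟨hbest₁, (hlast.resolve_left hlt.not_ge).mono hr (by linarith)⟩

/-! ### The parameters -/

/-- Compute `n` as a real number. -/
def countDisks : Prog :=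
  setR size (.lit 0) ;; forRange disk count (setR size (.add (rv size) (.lit 1)))

theorem countDisks_runs (h : s.nat count 0 = n) :
    Runs countDisks s (n + 1) fun s' => s'.real size 0 = n := by
  rw [← mul_one (n + 1)]
  refine .straight_seq rfl fun _ => .forRange (fun i s' => s'.real size 0 = i)
    (by simpa +decide using h) (by simp) fun i s' _ _ _ hi => .straight rfl ?_
  simp [hi]

/-- Halve `Reg.precision` until it is less than `Reg.eps / 8`. The number of iterations of the
ellipsoid method and the size of the net of directions grow along. -/
def setPrecision : Prog :=
  (setN iterations (.lit 1) ;; setN netSize (.lit 16) ;; setR precision (.lit 1)) ;;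
  .loop (.not (.realLt (.mul (.lit 8) (rv precision)) (rv eps)))
    (setN iterations (.add (nv iterations) (.lit 6)) ;;
      setN netSize (.add (nv netSize) (nv netSize)) ;;
      setR precision (.div (rv precision) (.lit 2)))

theorem setPrecision_runs {ε : ℝ} {j : ℕ} (hε : s.real eps 0 = ε) (hj : 8 * (1 / 2) ^ j < ε)
    (hj' : ε ≤ 16 * (1 / 2) ^ j) (hj₀ : 0 < j) :
    Runs setPrecision s (j + 1) fun s' => s'.real precision 0 = (1 / 2) ^ j ∧
      s'.nat iterations 0 = 6 * j + 1 ∧ s'.nat netSize 0 = 16 * 2 ^ j := by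
  rw [← mul_one (j + 1)]
  refine .straight_seq rfl fun hF₀ => .loop (fun m s' => ∃ i, i + m = j ∧
    s'.real precision 0 = (1 / 2) ^ i ∧ s'.nat iterations 0 = 6 * i + 1 ∧
    s'.nat netSize 0 = 16 * 2 ^ i) j ⟨0, by simp +decide⟩ ?_ ?_
  all_goals
    rintro m s' hF ⟨i, him, hprec, hiter, hnet⟩ hlt
    simp only [BExp.eval, RExp.eval, NExp.eval, hprec, hF.real eps 0, hF₀.real eps 0, hε, not_not,
      Rat.cast_ofNat] at hlt
  · obtain ⟨m, rfl⟩ : ∃ m', m = m' + 1 := Nat.exists_eq_succ_of_ne_zero fun hm =>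
      hlt (by rwa [← him, hm, add_zero] at hj)
    refine ⟨m, rfl, .straight rfl ⟨i + 1, by omega, ?_, ?_, ?_⟩⟩
    · simp +decide [hprec, pow_succ, div_eq_mul_inv]
    · simp +decide [hiter, mul_add, add_right_comm]
    · simp +decide [hnet, pow_succ, mul_two, mul_add]
  · suffices hij : j ≤ i by
      obtain rfl : i = j := by omega
      exact ⟨hprec, hiter, hnet⟩
    by_contra! hij
    have hpow : (1 / 2 : ℝ) ^ (j - 1) ≤ (1 / 2) ^ i :=
      pow_le_pow_of_le_one (by norm_num) (by norm_num) (by omega)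
    obtain ⟨j, rfl⟩ : ∃ j', j = j' + 1 := ⟨j - 1, by omega⟩
    rw [pow_succ] at hj'
    rw [Nat.add_sub_cancel] at hpow
    linarith

theorem exists_precision {ε : ℝ} (hε : 0 < ε) (hε₁ : ε ≤ 1) :
    ∃ j, 0 < j ∧ 8 * (1 / 2) ^ j < ε ∧ ε ≤ 16 * (1 / 2) ^ j := by
  obtain ⟨j, hlt, hle⟩ := exists_nat_pow_near_of_lt_one (x := ε / 8) (y := 1 / 2) (by positivity)
    (by linarith) (by norm_num) (by norm_num)
  rw [pow_succ] at hlt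
  exact ⟨j + 1, by omega, by rw [pow_succ]; linarith, by rw [pow_succ]; linarith⟩

/-! ### The first cover -/

/-- Find the disk farthest from the center of the disk number `0`. -/
def farthest : Prog :=
  (setV cover₁ (.cell center (.lit 0)) ;; setV cover₂ (.cell center (.lit 0)) ;;
    setR best (.cell radius (.lit 0))) ;;
  forRange disk count
    (.cond (.realLt (rv best) (reachExp cover₁))
      (setR best (reachExp cover₁) ;; setV cover₂ (.cell center (nv disk))) .skip)

theorem farthest_runs [NeZero n] (hL : Loaded c r s) :
    Runs farthest s (n + 1) fun s' => s'.vec cover₁ 0 = c 0 ∧ ∃ b, s'.vec cover₂ 0 = c b ∧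
      ∀ i, dist (c i) (c 0) + r i ≤ dist (c b) (c 0) + r b := by
  rw [← mul_one (n + 1)]
  have hcenter₀ : s.vec center 0 = c 0 := by simpa using hL.center 0
  have hradius₀ : s.real radius 0 = r 0 := by simpa using hL.radius 0
  refine .straight_seq rfl fun hF₀ => (Runs.forRange (n := n) (fun k s' =>
    s'.vec cover₁ 0 = c 0 ∧ ∃ b, s'.vec cover₂ 0 = c b ∧
      s'.real best 0 = dist (c b) (c 0) + r b ∧
      ∀ i : Fin n, i < k → dist (c i) (c 0) + r i ≤ s'.real best 0) ?_ ?_ ?_).imp ?_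
  · simpa +decide using hL.count
  · exact ⟨by simpa +decide using hcenter₀, 0, by simpa +decide using hcenter₀,
      by simpa +decide using hradius₀, by simp⟩
  · rintro i s' hF hi hdisk ⟨hcover₁, b, hcover₂, hbest, hmax⟩
    lift i to Fin n using hi
    have hL' : Loaded c r s' := (hL.frame hF₀).frame hF
    have hreach := eval_reachExp hL' hdisk cover₁
    rw [hcover₁, dist_comm] at hreach
    refine .cond (fun hlt => .straight rfl ?_) fun hge => .straight rfl ?_
    · simp only [BExp.eval, RExp.eval, NExp.eval, hreach] at hlt
      have hmax' := forall_val_lt_add_one (fun k hk => (hmax k hk).trans hlt.le) le_rfl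
      exact ⟨by simpa +decide using hcover₁, i, by simp +decide [hdisk, hL'.center],
        by simp +decide [hreach], by simpa +decide [hreach] using hmax'⟩
    · simp only [BExp.eval, RExp.eval, NExp.eval, hreach, not_lt] at hge
      exact ⟨hcover₁, b, hcover₂, hbest, forall_val_lt_add_one hmax hge⟩
  · rintro s' - ⟨hcover₁, b, hcover₂, hbest, hmax⟩
    exact ⟨hcover₁, b, hcover₂, fun i => hbest ▸ hmax i i.2⟩

/-- Compute the smallest cover centered at the center of the disk number `0` and at the center of
the disk farthest from it. -/
def firstCover : Prog :=
  farthest ;; setR best (.lit 0) ;;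
  forRange disk count
    (.cond (.and (.realLt (rv best) (reachExp cover₁)) (.realLt (rv best) (reachExp cover₂)))
      (.cond (.realLt (reachExp cover₁) (reachExp cover₂)) (setR best (reachExp cover₁))
        (setR best (reachExp cover₂))) .skip)

theorem firstCover_runs [NeZero n] (hL : Loaded c r s) (hr : ∀ i, 0 ≤ r i) :
    Runs firstCover s (n + 1) fun s' =>
      Covers c r (s'.vec cover₁ 0) (s'.vec cover₂ 0) (s'.real best 0) ∧
      IsApproxRadius c r 2 (s'.real best 0) := by
  rw [← mul_one (n + 1)]
  refine (mul_one (n + 1) ▸ farthest_runs hL).seq fun s₁ hF₁ ⟨hcover₁, b, hcover₂, hfar⟩ =>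
    .straight_seq rfl fun hF₂ => (Runs.forRange (n := n) (fun k s' =>
      (∀ i : Fin n, i < k → dist (c 0) (c i) + r i ≤ s'.real best 0 ∨
        dist (c b) (c i) + r i ≤ s'.real best 0) ∧
      IsApproxRadius c r 2 (s'.real best 0)) ?_ ?_ ?_).imp ?_
  · simpa +decide using (hL.frame hF₁).count
  · refine ⟨by simp, fun p₁ p₂ R hcov => ?_⟩
    simpa using hcov.nonneg hr
  · rintro i s' hF hi hdisk ⟨hcov, happrox⟩
    lift i to Fin n using hi
    have hL' : Loaded c r s' := ((hL.frame hF₁).frame hF₂).frame hF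
    have hreach₁ := eval_reachExp hL' hdisk cover₁
    have hreach₂ := eval_reachExp hL' hdisk cover₂
    rw [hF.vec cover₁ 0, hF₂.vec cover₁ 0, hcover₁] at hreach₁
    rw [hF.vec cover₂ 0, hF₂.vec cover₂ 0, hcover₂] at hreach₂
    have hnew : ∀ ρ, s'.real best 0 ≤ ρ →
        ρ = min (dist (c 0) (c i) + r i) (dist (c b) (c i) + r i) →
        (∀ j : Fin n, (j : ℕ) < i + 1 → dist (c 0) (c j) + r j ≤ ρ ∨ dist (c b) (c j) + r j ≤ ρ) ∧
          IsApproxRadius c r 2 ρ := fun ρ hρ hmin =>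
      ⟨forall_val_lt_add_one (fun j hj => (hcov j hj).imp hρ.trans' hρ.trans')
          (min_le_iff.1 hmin.ge), fun p₁ p₂ R h =>
        hmin.trans_le (min_le_iff.2 (h.two_mul_of_farthest hr hfar i))⟩
    refine .cond (fun hout => .cond (fun hlt => .straight rfl ?_) fun hge => .straight rfl ?_)
      fun hin => .straight rfl ?_
    · simp only [BExp.eval, RExp.eval, NExp.eval, hreach₁, hreach₂] at hout hlt
      simpa +decide [hreach₁] using hnew _ hout.1.le (min_eq_left hlt.le).symm
    · simp only [BExp.eval, RExp.eval, NExp.eval, hreach₁, hreach₂, not_lt] at hout hge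
      simpa +decide [hreach₂] using hnew _ hout.2.le (min_eq_right hge).symm
    · simp only [BExp.eval, RExp.eval, NExp.eval, hreach₁, hreach₂, not_and_or, not_lt] at hin
      exact ⟨forall_val_lt_add_one hcov hin, happrox⟩
  · rintro s₃ hF₃ ⟨hcov, happrox⟩
    rw [hF₃.vec cover₁ 0, hF₂.vec cover₁ 0, hcover₁, hF₃.vec cover₂ 0, hF₂.vec cover₂ 0, hcover₂]
    exact ⟨fun i => hcov i i.2, happrox⟩

/-! ### Candidate directions -/

/-- The stored directions. -/
def storedDirs (s : State) : Set Plane := {v | ∃ k < s.nat dirCount 0, s.vec dirs k = v}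

/-- `N` directions, among them those in `V`, are added to the stored ones. -/
def Grows (N : ℕ) (V : Set Plane) (s s' : State) : Prop :=
  s'.nat dirCount 0 = s.nat dirCount 0 + N ∧ storedDirs s ∪ V ⊆ storedDirs s'

theorem storedDirs_setNat {a i v : ℕ} (h : dirCount ≠ a) :
    storedDirs (s.setNat a i v) = storedDirs s := by
  simp [storedDirs, h]

theorem Grows.trans {N N' : ℕ} {V V' : Set Plane} (h : Grows N V s s') (h' : Grows N' V' s' s'') :
    Grows (N + N') (V ∪ V') s s'' := by
  refine ⟨by rw [h'.1, h.1, add_assoc], ?_⟩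
  rw [← Set.union_assoc]
  exact (Set.union_subset_union_left _ h.2).trans h'.2

/-- Store another direction. -/
def pushDir (e : VExp) : Prog := setVec dirs (nv dirCount) e ;; incr dirCount

theorem grows_pushDir {e : VExp} (he : dirs ∉ e.y.reads) :
    Grows 1 {e.eval s} s ((pushDir e).eff s) := by
  refine ⟨by simp [pushDir, he], Set.union_subset ?_ (Set.singleton_subset_iff.2 ?_)⟩
  · rintro v ⟨k, hk, rfl⟩
    exact ⟨k, by simp [pushDir, he, hk.trans], by simp [pushDir, he, hk.ne]⟩
  · exact ⟨s.nat dirCount 0, by simp [pushDir, he], by simp [pushDir, he]⟩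

theorem grows_forRange_runs {a b n N W : ℕ} {V : ℕ → Set Plane} {p : Prog} (hb : s.nat b 0 = n)
    (hstep : ∀ i s', Frame (forRange a b p) s s' → i < n → s'.nat a 0 = i →
      Runs p s' W (Grows N (V i) s'))
    (had : dirCount ≠ a := by decide) (ha : a ∉ p.natWrites := by decide)
    (hbp : b ∉ a :: p.natWrites := by decide) (hW : 0 < W := by positivity) :
    Runs (forRange a b p) s ((n + 1) * W) (Grows (n * N) {v | ∃ i < n, v ∈ V i} s) := by
  refine .forRange (fun i => Grows (i * N) {v | ∃ j < i, v ∈ V j} s) hb ?_ ?_ ha hbp hW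
  · simp [Grows, storedDirs, had]
  · intro i s' hF hi hai hG
    refine (hstep i s' hF hi hai).imp fun s'' _ hG' => ?_
    obtain ⟨hcount, hsub⟩ := hG.trans hG'
    refine ⟨by simp [had, hcount, add_mul], ?_⟩
    rw [storedDirs_setNat had]
    refine (Set.union_subset_union_right _ ?_).trans hsub
    rintro v ⟨j, hj, hv⟩
    rcases Nat.lt_succ_iff_lt_or_eq.1 hj with hj | rfl
    exacts [.inl ⟨j, hj, hv⟩, .inr hv]

/-- The bisector of the directions from `d j` to `d i` and from `d l` to `d k`, up to scaling. -/
noncomputable def bisector (d : ℕ → Plane) (i j k l : ℕ) : Plane :=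
  ‖d k - d l‖ • (d i - d j) + ‖d i - d j‖ • (d k - d l)

/-- The expression for `bisector`. -/
def bisectorExp : VExp :=
  let u : VExp := (VExp.cell center (nv idx₁)).sub (.cell center (nv idx₂))
  let v : VExp := (VExp.cell center (nv idx₃)).sub (.cell center (nv idx₄))
  (VExp.smul v.norm u).add (VExp.smul u.norm v)

/-- Store all bisectors. -/
def bisectorDirs : Prog :=
  setN dirCount (.lit 0) ;;
  forRange idx₁ count (forRange idx₂ count (forRange idx₃ count (forRange idx₄ count
    (pushDir bisectorExp))))

theorem bisectorDirs_runs (h : s.nat count 0 = n) :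
    Runs bisectorDirs s ((n + 1) ^ 4) fun s' => s'.nat dirCount 0 = n ^ 4 ∧
      ∀ i < n, ∀ j < n, ∀ k < n, ∀ l < n, bisector (s.vec center) i j k l ∈ storedDirs s' := by
  rw [show (n + 1) ^ 4 = (n + 1) * ((n + 1) * ((n + 1) * ((n + 1) * 1))) by ring]
  refine .straight_seq rfl fun hF₀ => (grows_forRange_runs (n := n) (N := n * (n * (n * 1)))
    (V := fun i => {v | ∃ j < n, v ∈ {v | ∃ k < n, v ∈ {v | ∃ l < n,
      v ∈ ({bisector (s.vec center) i j k l} : Set Plane)}}}) ?_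
    fun i s₁ hF₁ _ hi => grows_forRange_runs ?_ fun j s₂ hF₂ _ hj =>
    grows_forRange_runs ?_ fun k s₃ hF₃ _ hk => grows_forRange_runs ?_ fun l s₄ hF₄ _ hl =>
    .straight rfl ?_).imp ?_
  · simpa +decide using h
  · rwa [hF₁.nat count 0, hF₀.nat count 0]
  · rwa [hF₂.nat count 0, hF₁.nat count 0, hF₀.nat count 0]
  · rwa [hF₃.nat count 0, hF₂.nat count 0, hF₁.nat count 0, hF₀.nat count 0]
  · have hbis : bisectorExp.eval s₄ = bisector (s.vec center) i j k l := by
      have hcenter : s₄.vec center = s.vec center := funext fun m => by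
        rw [hF₄.vec center m, hF₃.vec center m, hF₂.vec center m, hF₁.vec center m,
          hF₀.vec center m]
      have hi₄ : s₄.nat idx₁ 0 = i := by
        rw [hF₄.nat idx₁ 0, hF₃.nat idx₁ 0, hF₂.nat idx₁ 0, hi]
      have hj₄ : s₄.nat idx₂ 0 = j := by rw [hF₄.nat idx₂ 0, hF₃.nat idx₂ 0, hj]
      have hk₄ : s₄.nat idx₃ 0 = k := by rw [hF₄.nat idx₃ 0, hk]
      simp [bisectorExp, bisector, hcenter, hi₄, hj₄, hk₄, hl]
    exact hbis ▸ grows_pushDir (by decide)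
  · rintro s' - ⟨hcount, hsub⟩
    refine ⟨hcount.trans (by simp; ring), fun i hi j hj k hk l hl => hsub (.inr ?_)⟩
    exact ⟨i, hi, j, hj, k, hk, l, hl, rfl⟩

/-- Store the directions with slope or inverse slope in a net of `[-1, 1]`. -/
def netDirs : Prog :=
  (setN dirCount (.lit 0) ;; setR slope (.lit (-1)) ;; setN netSize (.add (nv netSize) (.lit 1)))
    ;; forRange idx₁ netSize
      (pushDir ⟨.lit 1, rv slope⟩ ;; pushDir ⟨rv slope, .lit 1⟩ ;;
        setR slope (.add (rv slope) (.div (rv precision) (.lit 8))))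

theorem netDirs_runs {N : ℕ} {h : ℝ} (hN : s.nat netSize 0 = N) (hh : s.real precision 0 / 8 = h) :
    Runs netDirs s (N + 2) fun s' => s'.nat dirCount 0 = (N + 1) * 2 ∧
      ∀ i ≤ N, !₂[1, -1 + i * h] ∈ storedDirs s' ∧ !₂[-1 + i * h, 1] ∈ storedDirs s' := by
  rw [← mul_one (N + 2)]
  refine .straight_seq rfl fun hF₀ => (Runs.forRange (n := N + 1) (fun i s' =>
    s'.real slope 0 = -1 + i * h ∧ s'.nat dirCount 0 = i * 2 ∧
      ∀ j < i, !₂[1, -1 + j * h] ∈ storedDirs s' ∧ !₂[-1 + j * h, 1] ∈ storedDirs s')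
    ?_ ?_ ?_).imp ?_
  · simp +decide [hN]
  · simp +decide
  · rintro i s₁ hF₁ hi hidx ⟨hslope, hcount, hdirs⟩
    have hpush := (grows_pushDir (s := s₁) (e := ⟨.lit 1, rv slope⟩) (by decide)).trans
      (grows_pushDir (e := ⟨rv slope, .lit 1⟩) (by decide))
    refine .straight_seq rfl fun hF₂ => .straight_seq rfl fun hF₃ => ?_
    generalize Prog.eff _ s₁ = s₂ at *
    generalize Prog.eff _ s₂ = s₃ at *
    have hslope₃ : s₃.real slope 0 = -1 + i * h := by
      rw [hF₃.real slope 0, hF₂.real slope 0, hslope]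
    have hprec₃ : s₃.real precision 0 = s.real precision 0 := by
      rw [hF₃.real precision 0, hF₂.real precision 0, hF₁.real precision 0, hF₀.real precision 0]
    refine .straight rfl ⟨?_, ?_, ?_⟩
    · simp [hslope₃, hprec₃, hh]
      ring
    · simp +decide [hpush.1, hcount, add_mul]
    · obtain ⟨hnew₂, hnew₁, hold⟩ : !₂[-1 + i * h, 1] ∈ storedDirs s₃ ∧
          !₂[1, -1 + i * h] ∈ storedDirs s₃ ∧ storedDirs s₁ ⊆ storedDirs s₃ := by
        simpa [VExp.eval, hslope, hF₂.real slope 0, Set.insert_subset_iff] using hpush.2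
      intro j hj
      rw [storedDirs_setNat (by decide), show storedDirs _ = storedDirs s₃ by
        simp +decide [storedDirs]]
      rcases Nat.lt_succ_iff_lt_or_eq.1 hj with hj | rfl
      exacts [(hdirs j hj).imp (@hold _) (@hold _), ⟨hnew₁, hnew₂⟩]
  · rintro s' - ⟨-, hcount, hdirs⟩
    exact ⟨hcount, fun i hi => hdirs i (by omega)⟩

/-! ### The algorithm -/

variable {j : ℕ}

theorem pow_lt_precision (j : ℕ) : (7 / 9 : ℝ) ^ (6 * j + 1) < ((1 / 2) ^ j) ^ 2 :=
  calc (7 / 9 : ℝ) ^ (6 * j + 1) = ((7 / 9) ^ 6) ^ j * (7 / 9) := by rw [pow_succ, pow_mul]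
    _ < ((7 / 9) ^ 6) ^ j := mul_lt_of_lt_one_right (by positivity) (by norm_num)
    _ ≤ ((1 / 2) ^ 2) ^ j := pow_le_pow_left₀ (by norm_num) (by norm_num) j
    _ = ((1 / 2) ^ j) ^ 2 := pow_right_comm ..

theorem exists_abs_net_sub_le {N : ℕ} {h x : ℝ} (hh : 0 < h) (hN : N * h = 2) (hx : |x| ≤ 1) :
    ∃ i ≤ N, |-1 + i * h - x| ≤ h := by
  obtain ⟨hx₀, hx₁⟩ := abs_le.1 hx
  refine ⟨⌊(x + 1) / h⌋₊, Nat.floor_le_of_le ?_, ?_⟩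
  · rw [div_le_iff₀ hh]
    linarith
  · have hle := (le_div_iff₀ hh).1 (Nat.floor_le (div_nonneg (by linarith : 0 ≤ x + 1) hh.le))
    have hlt := (div_lt_iff₀ hh).1 (Nat.lt_floor_add_one ((x + 1) / h))
    rw [abs_le]
    constructor <;> linarith

theorem Covers.exists_mem_storedDirs_of_net {p₁ p₂ : Plane} {R h : ℝ} {N : ℕ}
    (hcov : Covers c r p₁ p₂ R) (hr : ∀ i, 0 ≤ r i) (hh : 0 < h) (hh₁ : h ≤ 1 / 3) (hN : N * h = 2)
    (hdirs : ∀ i ≤ N, !₂[1, -1 + i * h] ∈ storedDirs s ∧ !₂[-1 + i * h, 1] ∈ storedDirs s) :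
    ∃ v ∈ storedDirs s, HasSplit c r v ((1 + 6 * h) * R) := by
  obtain ⟨_, ⟨i, hi, rfl⟩, hsplit⟩ := hcov.exists_hasSplit_of_net hr
    (net := {x | ∃ i : ℕ, i ≤ N ∧ -1 + i * h = x}) hh₁ fun x hx =>
      let ⟨i, hi, hix⟩ := exists_abs_net_sub_le hh hN hx
      ⟨_, ⟨i, hi, rfl⟩, hix⟩
  exact hsplit.elim (⟨_, (hdirs i hi).1, ·⟩) (⟨_, (hdirs i hi).2, ·⟩)

/-- Improve the cover with the directions of a net. -/
def netSearch : Prog := netDirs ;; setR factor (rv precision) ;; passes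

theorem netSearch_runs [NeZero n] (hL : Loaded c r s) (hr : ∀ i, 0 ≤ r i)
    (hj : (1 / 2 : ℝ) ^ j ≤ 1 / 8) (hprec : s.real precision 0 = (1 / 2) ^ j)
    (hiter : s.nat iterations 0 = 6 * j + 1) (hnet : s.nat netSize 0 = 16 * 2 ^ j)
    (hbest : HasCover c r s) (happrox : IsApproxRadius c r 2 (s.real best 0)) :
    Runs netSearch s (1032 * (n * 2 ^ j * (j + 1))) fun s' =>
      HasCover c r s' ∧ IsApproxRadius c r (1 + 8 * (1 / 2) ^ j) (s'.real best 0) := by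
  have hn : 1 ≤ n := NeZero.one_le
  have hpow : 1 ≤ 2 ^ j := Nat.one_le_two_pow
  set θ : ℝ := (1 / 2) ^ j with hθ
  have hθ₀ : 0 < θ := by positivity
  have hθ_mul : (2 : ℝ) ^ j * θ = 1 := by rw [hθ, ← mul_pow]; norm_num
  refine ((netDirs_runs hnet (h := θ / 8) (by rw [hprec])).mono ?_ fun _ _ => id).seq
    fun s₁ hF₁ ⟨hcount, hdirs⟩ => .straight_seq rfl fun hF₂ => ?_
  · calc 16 * 2 ^ j + 2 ≤ 1032 * (1 * 2 ^ j * 1) := by omega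
      _ ≤ _ := by gcongr; omega
  have hfactor : ((setR factor (rv precision)).eff s₁).real factor 0 = θ := by
    simp [hF₁.real precision 0, hprec]
  generalize Prog.eff _ s₁ = s₂ at *
  have hbest₂ : s₂.real best 0 = s.real best 0 := by rw [hF₂.real best 0, hF₁.real best 0]
  refine (passes_runs (N := (16 * 2 ^ j + 1) * 2) (M := 8 * 2 ^ j) (L := 1)
    ((hL.frame hF₁).frame hF₂) hr hθ₀ hj (by rw [hF₂.nat iterations 0, hF₁.nat iterations 0, hiter])
    (pow_lt_precision j) (by rw [hF₂.nat dirCount 0, hcount])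
    (by rw [hF₂.real precision 0, hF₁.real precision 0, hprec]) hfactor.ge (by linarith) (by omega)
    ((hbest.frame hF₁).frame hF₂) ?_ fun p₁ p₂ R hcov => ?_).mono ?_ fun _ _ => id
  · rw [hbest₂, hfactor]
    refine happrox.mono hr ?_
    push_cast
    linarith
  · obtain ⟨v, ⟨k, hk, rfl⟩, hv⟩ := hcov.exists_mem_storedDirs_of_net hr (by linarith)
      (by linarith) (by push_cast; linarith) hdirs
    refine ⟨k, hcount ▸ hk, ?_⟩
    rw [hF₂.vec dirs k]
    exact hv.mono (mul_le_mul_of_nonneg_right (by linarith) (hcov.nonneg hr))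
  · calc (1 + 1) * (((16 * 2 ^ j + 1) * 2 + 8 * 2 ^ j + 1) * ((6 * j + 1 + 1) * (n + 1)))
        ≤ 2 * ((43 * 2 ^ j) * ((6 * (j + 1)) * (2 * n))) := by gcongr <;> omega
      _ = _ := by ring

/-- Improve the cover with all bisectors as directions. -/
def bisectorSearch : Prog := bisectorDirs ;; setR factor (.lit 1) ;; passes

theorem bisectorSearch_runs [NeZero n] (hL : Loaded c r s) (hr : ∀ i, 0 ≤ r i)
    (hj : (1 / 2 : ℝ) ^ j ≤ 1 / 8) (hprec : s.real precision 0 = (1 / 2) ^ j)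
    (hiter : s.nat iterations 0 = 6 * j + 1)
    (hbest : HasCover c r s) (happrox : IsApproxRadius c r 2 (s.real best 0)) :
    Runs bisectorSearch s (1032 * (n ^ 5 * (j + 1) ^ 2)) fun s' =>
      HasCover c r s' ∧ IsApproxRadius c r (1 + 8 * (1 / 2) ^ j) (s'.real best 0) := by
  have hn : 1 ≤ n := NeZero.one_le
  have hpow : 1 ≤ n ^ 4 := Nat.one_le_pow _ _ hn
  set θ : ℝ := (1 / 2) ^ j with hθ
  have hθ₀ : 0 < θ := by positivity
  have hθ_mul : θ * (2 : ℝ) ^ j = 1 := by rw [hθ, ← mul_pow]; norm_num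
  refine ((bisectorDirs_runs hL.count).mono ?_ fun _ _ => id).seq
    fun s₁ hF₁ ⟨hcount, hdirs⟩ => .straight_seq rfl fun hF₂ => ?_
  · calc (n + 1) ^ 4 ≤ (2 * n) ^ 4 := by gcongr; omega
      _ = 16 * (n ^ 4 * 1 ^ 2) := by ring
      _ ≤ _ := by gcongr <;> omega
  have hfactor : ((setR factor (.lit 1)).eff s₁).real factor 0 = 1 := by simp
  generalize Prog.eff _ s₁ = s₂ at *
  have hbest₂ : s₂.real best 0 = s.real best 0 := by rw [hF₂.real best 0, hF₁.real best 0]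
  refine (passes_runs (N := n ^ 4) (M := 8) (L := j + 1)
    ((hL.frame hF₁).frame hF₂) hr hθ₀ hj (by rw [hF₂.nat iterations 0, hF₁.nat iterations 0, hiter])
    (pow_lt_precision j) (by rw [hF₂.nat dirCount 0, hcount])
    (by rw [hF₂.real precision 0, hF₁.real precision 0, hprec]) (by linarith)
    (by rw [hfactor, pow_succ]; linarith) le_rfl
    ((hbest.frame hF₁).frame hF₂) ?_ fun p₁ p₂ R hcov => ?_).mono ?_ fun _ _ => id
  · rw [hbest₂, hfactor]
    exact happrox.mono hr (by norm_num)
  · obtain ⟨i₁, i₂, i₃, i₄, hsplit⟩ := hcov.exists_hasSplit_bisector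
    simp only [← hL.center] at hsplit
    obtain ⟨k, hk, hbis⟩ := hdirs i₁ i₁.2 i₂ i₂.2 i₃ i₃.2 i₄ i₄.2
    refine ⟨k, hcount ▸ hk, ?_⟩
    rw [hF₂.vec dirs k, hbis]
    exact HasSplit.mono hsplit (le_mul_of_one_le_left (hcov.nonneg hr) (by linarith))
  · calc (j + 1 + 1) * ((n ^ 4 + 8 + 1) * ((6 * j + 1 + 1) * (n + 1)))
        ≤ (2 * (j + 1)) * ((10 * n ^ 4) * ((6 * (j + 1)) * (2 * n))) := by gcongr <;> omega
      _ = 240 * (n ^ 5 * (j + 1) ^ 2) := by ring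
      _ ≤ _ := by gcongr; omega

/-- Improve the cover. If there are few disks, then the bisectors give an exact direction at a cost
that does not grow with the precision; otherwise, the net is smaller. -/
def search : Prog :=
  let sq (e : RExp) : RExp := .mul e e
  .cond (.realLt (.lit 1) (.mul (sq (sq (sq (rv size)))) (rv eps))) netSearch bisectorSearch

theorem search_runs [NeZero n] {ε : ℝ} {W : ℕ} (hL : Loaded c r s) (hr : ∀ i, 0 ≤ r i)
    (hj : (1 / 2 : ℝ) ^ j ≤ 1 / 8) (hsize : s.real size 0 = n) (hε : s.real eps 0 = ε)
    (hprec : s.real precision 0 = (1 / 2) ^ j) (hiter : s.nat iterations 0 = 6 * j + 1)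
    (hnet : s.nat netSize 0 = 16 * 2 ^ j) (hbest : HasCover c r s)
    (happrox : IsApproxRadius c r 2 (s.real best 0)) (hW : 0 < W)
    (hW₁ : 1 < n ^ 8 * ε → n * 2 ^ j * (j + 1) ≤ W)
    (hW₂ : n ^ 8 * ε ≤ 1 → n ^ 5 * (j + 1) ^ 2 ≤ W) :
    Runs search s (1032 * W) fun s' =>
      HasCover c r s' ∧ IsApproxRadius c r (1 + 8 * (1 / 2) ^ j) (s'.real best 0) := by
  refine .cond (fun hlt => ?_) fun hge => ?_
  all_goals
    simp only [BExp.eval, RExp.eval, NExp.eval, hsize, hε, Rat.cast_one, not_lt,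
      show (n : ℝ) * n * (n * n) * (n * n * (n * n)) = n ^ 8 by ring] at *
  · exact (netSearch_runs hL hr hj hprec hiter hnet hbest happrox).mono
      (Nat.mul_le_mul_left _ (hW₁ hlt)) fun _ _ => id
  · exact (bisectorSearch_runs hL hr hj hprec hiter hbest happrox).mono
      (Nat.mul_le_mul_left _ (hW₂ hge)) fun _ _ => id

/-- Copy the best cover to the output array. -/
def writeOutput : Prog :=
  .setReal output (.lit 0) (rv cover₁) ;; .setReal output (.lit 1) (rv (cover₁ + 1)) ;;
  .setReal output (.lit 2) (rv best) ;; .setReal output (.lit 3) (rv cover₂) ;;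
  .setReal output (.lit 4) (rv (cover₂ + 1)) ;; .setReal output (.lit 5) (rv best)

/-- The approximation algorithm. The search is skipped for a first cover of radius `0`: it lowers
the radius by factors, and its ellipses would degenerate. -/
def approxProg : Prog :=
  countDisks ;; setPrecision ;; firstCover ;;
    .cond (.realLt (.lit 0) (rv best)) search .skip ;; writeOutput

theorem mul_add_one_le_mul_two_pow (n j : ℕ) : n * (j + 1) ≤ n * 2 ^ j * (j + 1) :=
  Nat.mul_le_mul_right _ (Nat.le_mul_of_pos_right _ (by positivity))

theorem mul_add_one_le_pow_mul_sq (n j : ℕ) : n * (j + 1) ≤ n ^ 5 * (j + 1) ^ 2 :=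
  Nat.mul_le_mul (Nat.le_self_pow (by norm_num) _) (Nat.le_self_pow (by norm_num) _)

theorem approxProg_runs [NeZero n] {ε : ℝ} {W : ℕ} (hL : Loaded c r s) (hr : ∀ i, 0 ≤ r i)
    (hε : s.real eps 0 = ε) (hε₁ : ε ≤ 1) (hj : 8 * (1 / 2) ^ j < ε) (hj' : ε ≤ 16 * (1 / 2) ^ j)
    (hj₀ : 0 < j)
    (hW₁ : 1 < n ^ 8 * ε → n * 2 ^ j * (j + 1) ≤ W)
    (hW₂ : n ^ 8 * ε ≤ 1 → n ^ 5 * (j + 1) ^ 2 ≤ W) :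
    Runs approxProg s (1032 * W) fun s' =>
      s'.real output 5 = s'.real output 2 ∧
      Covers c r !₂[s'.real output 0, s'.real output 1] !₂[s'.real output 3, s'.real output 4]
        (s'.real output 2) ∧
      IsApproxRadius c r (1 + ε) (s'.real output 2) := by
  have hn : 1 ≤ n := NeZero.one_le
  have hnj : n * (j + 1) ≤ W := (lt_or_ge 1 (n ^ 8 * ε)).elim
    (fun h => (mul_add_one_le_mul_two_pow n j).trans (hW₁ h))
    fun h => (mul_add_one_le_pow_mul_sq n j).trans (hW₂ h)
  have hnW : n ≤ W := le_trans (Nat.le_mul_of_pos_right _ j.succ_pos) hnj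
  have hjW : j + 1 ≤ W := le_trans (Nat.le_mul_of_pos_left _ hn) hnj
  refine ((countDisks_runs hL.count).mono (by omega) fun _ _ => id).seq fun s₁ hF₁ hsize =>
    ((setPrecision_runs ((hF₁.real eps 0).trans hε) hj hj' hj₀).mono (by omega)
      fun _ _ => id).seq fun s₂ hF₂ ⟨hprec, hiter, hnet⟩ =>
    ((firstCover_runs ((hL.frame hF₁).frame hF₂) hr).mono (by omega) fun _ _ => id).seq
      fun s₃ hF₃ ⟨hcov, happrox⟩ => .seq (Q := fun s' =>
        Covers c r (s'.vec cover₁ 0) (s'.vec cover₂ 0) (s'.real best 0) ∧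
        IsApproxRadius c r (1 + ε) (s'.real best 0))
      (.cond (fun hpos => ?_) (fun hzero => .straight rfl ?_ (by omega)) (by omega))
      fun s₄ _ ⟨hcov₄, happrox₄⟩ => .straight rfl ?_ (by omega)
  · simp only [BExp.eval, RExp.eval, NExp.eval, Rat.cast_zero] at hpos
    refine (search_runs (((hL.frame hF₁).frame hF₂).frame hF₃) hr (by linarith)
      (by rw [hF₃.real size 0, hF₂.real size 0, hsize])
      (by rw [hF₃.real eps 0, hF₂.real eps 0, hF₁.real eps 0, hε])
      (by rw [hF₃.real precision 0, hprec]) (by rw [hF₃.nat iterations 0, hiter])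
      (by rw [hF₃.nat netSize 0, hnet]) ⟨hpos, hcov⟩ happrox (by omega) hW₁ hW₂).imp ?_
    exact fun s' _ h => ⟨h.1.covers, h.2.mono hr (by linarith)⟩
  · simp only [BExp.eval, RExp.eval, NExp.eval, Rat.cast_zero, not_lt] at hzero
    refine ⟨hcov, fun p₁ p₂ R h => hzero.trans (mul_nonneg ?_ (h.nonneg hr))⟩
    linarith [show (0 : ℝ) < (1 / 2) ^ j by positivity]
  · simpa +decide [writeOutput, State.vec] using And.intro hcov₄ happrox₄

/-! ### The running time -/

section Time

variable {ε : ℝ}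

theorem half_le_log_add_one (hn : 1 ≤ n) : 1 / 2 ≤ Real.log (n + 1) := by
  have hlog : Real.log 2 ≤ Real.log (n + 1) :=
    Real.log_le_log (by norm_num) (by norm_cast; omega)
  linarith [Real.log_two_gt_d9]

theorem two_pow_mul_le (hj : ε ≤ 16 * (1 / 2) ^ j) : 2 ^ j * ε ≤ 16 :=
  calc 2 ^ j * ε ≤ 2 ^ j * (16 * (1 / 2) ^ j) := by gcongr
    _ = 16 * (2 * (1 / 2)) ^ j := by rw [mul_pow]; ring
    _ = 16 := by norm_num

theorem mul_two_pow_mul_le (hn : 1 ≤ n) (hε : 0 < ε) (hj : ε ≤ 16 * (1 / 2) ^ j)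
    (h : 1 < n ^ 8 * ε) :
    (n * 2 ^ j * (j + 1) : ℝ) ≤ 512 * (n / ε * Real.log (n + 1)) := by
  have hlog := half_le_log_add_one hn
  have hj_log : j ≤ 24 * Real.log (n + 1) := by
    have hpow : (2 : ℝ) ^ j ≤ 2 ^ 4 * (n + 1) ^ 8 := by
      refine le_of_mul_le_mul_right (a := ε) ?_ hε
      calc 2 ^ j * ε ≤ 2 ^ 4 * (n ^ 8 * ε) := by linarith [two_pow_mul_le hj]
        _ ≤ 2 ^ 4 * (n + 1) ^ 8 * ε := by
          rw [mul_assoc]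
          gcongr
          linarith
    have hlog_pow := Real.log_le_log (by positivity) hpow
    rw [Real.log_mul (by positivity) (by positivity), Real.log_pow, Real.log_pow,
      Real.log_pow] at hlog_pow
    push_cast at hlog_pow
    nlinarith [Real.log_two_gt_d9, Real.log_two_lt_d9, (Nat.cast_nonneg j : (0 : ℝ) ≤ j)]
  have hpow : (2 : ℝ) ^ j ≤ 16 / ε := (le_div_iff₀ hε).2 (two_pow_mul_le hj)
  calc (n * 2 ^ j * (j + 1) : ℝ) ≤ n * (16 / ε) * (32 * Real.log (n + 1)) := by
        gcongr
        linarith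
    _ = 512 * (n / ε * Real.log (n + 1)) := by ring

theorem add_one_pow_four_le (j : ℕ) : ((j : ℝ) + 1) ^ 4 ≤ 4096 * 2 ^ j :=
  calc ((j : ℝ) + 1) ^ 4 ≤ (8 * (1 + j * (1 / 8))) ^ 4 := by gcongr; linarith
    _ ≤ (8 * (1 + 1 / 8) ^ j) ^ 4 := by
      gcongr
      exact one_add_mul_le_pow (by norm_num) j
    _ = 4096 * ((1 + 1 / 8) ^ 4) ^ j := by rw [mul_pow, pow_right_comm]; norm_num
    _ ≤ 4096 * 2 ^ j := by gcongr; norm_num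

theorem pow_mul_sq_le (hn : 1 ≤ n) (hε : 0 < ε) (hj : ε ≤ 16 * (1 / 2) ^ j)
    (h : n ^ 8 * ε ≤ 1) :
    (n ^ 5 * (j + 1) ^ 2 : ℝ) ≤ 512 * (n / ε * Real.log (n + 1)) := by
  have hsq : (n ^ 4 * (j + 1) ^ 2 * ε : ℝ) ≤ 256 := by
    refine le_of_sq_le_sq ?_ (by norm_num)
    calc (n ^ 4 * (j + 1) ^ 2 * ε) ^ 2 = (n ^ 8 * ε) * ((j + 1) ^ 4 * ε) := by ring
      _ ≤ 1 * (4096 * 2 ^ j * ε) := by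
        gcongr
        exact add_one_pow_four_le j
      _ ≤ 256 ^ 2 := by linarith [two_pow_mul_le hj]
  calc (n ^ 5 * (j + 1) ^ 2 : ℝ) = n * (n ^ 4 * (j + 1) ^ 2 * ε) / ε := by field_simp
    _ ≤ n * 256 / ε * 1 := by rw [mul_one]; gcongr
    _ ≤ n * 256 / ε * (2 * Real.log (n + 1)) := by
      gcongr
      linarith [half_le_log_add_one hn]
    _ = 512 * (n / ε * Real.log (n + 1)) := by ring

end Time

/-! ### Input and output -/

theorem loaded_input (ε : ℝ) (D : Fin n → Disk) :
    Loaded (fun i => (D i).center) (fun i => (D i).radius) (input ε D) where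
  count := by simp [input]
  center i := by ext k; fin_cases k <;> simp [input, State.vec]
  radius i := by simp [input]

theorem isRestrictedCover_iff {D : Fin n → Disk} {C₁ C₂ : Disk} (h : C₁.radius = C₂.radius) :
    IsRestrictedCover D C₁ C₂ ↔
      Covers (fun i => (D i).center) (fun i => (D i).radius) C₁.center C₂.center C₁.radius := by
  simp only [IsRestrictedCover, Disk.carrier, Covers, h, true_and,
    closedBall_subset_closedBall_iff (D _).radius_nonneg]

theorem approxProg_input_runs [NeZero n] {ε : ℝ} (hε : 0 < ε) (hε₁ : ε ≤ 1) (D : Fin n → Disk) :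
    Runs approxProg (input ε D) (1032 * ⌊512 * (n / ε * Real.log (n + 1))⌋₊) fun s =>
      ∃ C₁ C₂, IsOutput s C₁ C₂ ∧ IsApproxRestrictedCover (1 + ε) D C₁ C₂ := by
  have hn : 1 ≤ n := NeZero.one_le
  obtain ⟨j, hj₀, hj, hj'⟩ := exists_precision hε hε₁
  refine (approxProg_runs (loaded_input ε D) (fun i => (D i).radius_nonneg) (by simp [input]) hε₁ hj
    hj' hj₀ (fun h => Nat.le_floor ?_) (fun h => Nat.le_floor ?_)).imp ?_
  · push_cast
    exact mul_two_pow_mul_le hn hε hj' h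
  · push_cast
    exact pow_mul_sq_le hn hε hj' h
  · rintro s - ⟨hradius, hcov, happrox⟩
    have hR := hcov.nonneg fun i => (D i).radius_nonneg
    let C₁ : Disk := ⟨!₂[s.real 4 0, s.real 4 1], s.real 4 2, hR⟩
    let C₂ : Disk := ⟨!₂[s.real 4 3, s.real 4 4], s.real 4 2, hR⟩
    have hC : C₁.radius = C₂.radius := rfl
    exact ⟨C₁, C₂, by simp [IsOutput, C₁, C₂, hradius], (isRestrictedCover_iff hC).2 hcov,
      fun C₁' C₂' h => happrox _ _ _ ((isRestrictedCover_iff h.1).1 h)⟩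

end TwoCenter

theorem mainTheorem6 :
    ∃ (P : RealRAM.Prog) (K : ℝ), ∀ (ε : ℝ), 0 < ε → ε ≤ 1 →
      ∀ (n : ℕ), 1 ≤ n → ∀ (D : Fin n → TwoCenter.Disk),
        ∃ (t : ℕ) (s : RealRAM.State) (C₁ C₂ : TwoCenter.Disk),
          RealRAM.Exec P (TwoCenter.input ε D) t s ∧
          (t : ℝ) ≤ K * ((n : ℝ) / ε * Real.log ((n : ℝ) + 1)) ∧
          TwoCenter.IsOutput s C₁ C₂ ∧
          TwoCenter.IsApproxRestrictedCover (1 + ε) D C₁ C₂ := by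
  refine ⟨TwoCenter.approxProg, TwoCenter.approxProg.size * (1032 * 512),
    fun ε hε hε₁ n hn D => ?_⟩
  have : NeZero n := ⟨by omega⟩
  obtain ⟨t, s, hexec, ht, C₁, C₂, hout, hcover⟩ := TwoCenter.approxProg_input_runs hε hε₁ D
  refine ⟨t, s, C₁, C₂, hexec, ?_, hout, hcover⟩
  have hlog := TwoCenter.half_le_log_add_one hn
  calc (t : ℝ) ≤ (TwoCenter.approxProg.size *
        (1032 * ⌊512 * (n / ε * Real.log (n + 1))⌋₊) : ℕ) := by exact_mod_cast ht
    _ ≤ TwoCenter.approxProg.size * (1032 * (512 * (n / ε * Real.log (n + 1)))) := by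
      push_cast
      gcongr
      exact Nat.floor_le (by positivity)
    _ = TwoCenter.approxProg.size * (1032 * 512) * (n / ε * Real.log (n + 1)) := by ring
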